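/- Let $G$ be a (finite-dimensional real) Lie group with Lie algebra $\mathfrak g$, and let $(U,\mathcal H)$ be a unitary representation of $G$, i.e. a strongly continuous homomorphism $U$ from $G$ into the unitary group of a complex Hilbert space $\mathcal H$. Let $\mathcal H^\infty$ (resp. $\mathcal H^\omega$) be the space of those $v \in \mathcal H$ whose orbit map $G \to \mathcal H$, $g \mapsto U(g)v$, is smooth (resp. real analytic), so that $\mathcal H^\omega \subseteq \mathcal H^\infty \subseteq \mathcal H$. For $x \in \mathfrak g$ and $v \in \mathcal H^\infty$ put $\mathtt{d}U(x)v = \frac{d}{dt}\big|_{t=0} U(\exp tx)v$; this is a representation of $\mathfrak g$ on $\mathcal H^\infty$, which extends to the universal enveloping algebra $\mathcal U(\mathfrak g)$. Endow $\mathcal H^\infty$ with its Fréchet topology, which is defined by the seminorms $v \mapsto \|\mathtt{d}U(D)v\|$, $D \in \mathcal U(\mathfrak g)$. Then $\mathcal H^\omega$ is dense in $\mathcal H^\infty$ with respect to this topology. -/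

import Mathlib

open scoped Manifold ContDiff Topology

namespace UnitaryLieRep

noncomputable section

/-! ### Derivatives of vector valued functions along vector fields -/

section Commutator

variable {E : Type*} [NormedAddCommGroup E] [NormedSpace ℝ E]
  {M : Type*} [TopologicalSpace M] [ChartedSpace E M]
  {F : Type*} [NormedAddCommGroup F] [NormedSpace ℝ F]

/-- The directional derivative at `x`, along the tangent vector `ξ`, of a function with values
in a normed space. -/
def dirDeriv (f : M → F) (x : M) (ξ : TangentSpace 𝓘(ℝ, E) x) : F :=
  mfderiv 𝓘(ℝ, E) 𝓘(ℝ, F) f x ξ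

variable [CompleteSpace E] [IsManifold 𝓘(ℝ, E) 2 M]

open VectorField in
/-- Vector fields act on functions in such a way that the Lie bracket is the commutator. -/
theorem dirDeriv_mlieBracket {f : M → F} (hf : ContMDiff 𝓘(ℝ, E) 𝓘(ℝ, F) 2 f)
    {V W : Π x : M, TangentSpace 𝓘(ℝ, E) x} {x : M}
    (hV : MDifferentiableAt 𝓘(ℝ, E) 𝓘(ℝ, E).tangent
      (fun y ↦ (V y : TangentBundle 𝓘(ℝ, E) M)) x)
    (hW : MDifferentiableAt 𝓘(ℝ, E) 𝓘(ℝ, E).tangent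
      (fun y ↦ (W y : TangentBundle 𝓘(ℝ, E) M)) x)
    (hfV : MDifferentiableAt 𝓘(ℝ, E) 𝓘(ℝ, F) (fun y ↦ dirDeriv f y (V y)) x)
    (hfW : MDifferentiableAt 𝓘(ℝ, E) 𝓘(ℝ, F) (fun y ↦ dirDeriv f y (W y)) x) :
    dirDeriv f x (mlieBracket 𝓘(ℝ, E) V W x) =
      dirDeriv (fun y ↦ dirDeriv f y (W y)) x (V x) -
        dirDeriv (fun y ↦ dirDeriv f y (V y)) x (W x) := by
  set φ := extChartAt 𝓘(ℝ, E) x with hφ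
  have hr : Set.range 𝓘(ℝ, E) = Set.univ := by simp
  set V' : E → E := mpullbackWithin 𝓘(ℝ, E) 𝓘(ℝ, E) φ.symm V (Set.range 𝓘(ℝ, E)) with hV'
  set W' : E → E := mpullbackWithin 𝓘(ℝ, E) 𝓘(ℝ, E) φ.symm W (Set.range 𝓘(ℝ, E)) with hW'
  have dV : DifferentiableAt ℝ V' (φ x) := by
    have : DifferentiableWithinAt ℝ V' (φ.symm ⁻¹' Set.univ ∩ Set.range 𝓘(ℝ, E)) (φ x) :=
      (hV.mdifferentiableWithinAt
        (s := Set.univ)).differentiableWithinAt_mpullbackWithin_vectorField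
    rwa [hr, Set.preimage_univ, Set.univ_inter, differentiableWithinAt_univ] at this
  have dW : DifferentiableAt ℝ W' (φ x) := by
    have : DifferentiableWithinAt ℝ W' (φ.symm ⁻¹' Set.univ ∩ Set.range 𝓘(ℝ, E)) (φ x) :=
      (hW.mdifferentiableWithinAt
        (s := Set.univ)).differentiableWithinAt_mpullbackWithin_vectorField
    rwa [hr, Set.preimage_univ, Set.univ_inter, differentiableWithinAt_univ] at this
  have tgt : φ.target ∈ 𝓝 (φ x) := extChartAt_target_mem_nhds x
  have hx : φ x ∈ φ.target := mem_extChartAt_target x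
  have hsx : φ.symm (φ x) = x := extChartAt_to_inv x
  have hsymm : ∀ y ∈ φ.target, ContMDiffAt 𝓘(ℝ, E) 𝓘(ℝ, E) 2 φ.symm y := fun y hy ↦ by
    have := contMDiffWithinAt_extChartAt_symm_range (I := 𝓘(ℝ, E)) (n := 2) x hy
    rwa [hr, contMDiffWithinAt_univ] at this
  have chain : ∀ (h : M → F), ∀ y ∈ φ.target,
      MDifferentiableAt 𝓘(ℝ, E) 𝓘(ℝ, F) h (φ.symm y) → ∀ (Z : Π x : M, TangentSpace 𝓘(ℝ, E) x),
      (fderiv ℝ (h ∘ φ.symm) y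
        (mpullbackWithin 𝓘(ℝ, E) 𝓘(ℝ, E) φ.symm Z (Set.range 𝓘(ℝ, E)) y) : F) =
        dirDeriv h (φ.symm y) (Z (φ.symm y)) := by
    intro h y hy hh Z
    have inv := isInvertible_mfderivWithin_extChartAt_symm (I := 𝓘(ℝ, E)) hy
    have e1 := mfderiv_comp y hh ((hsymm y hy).mdifferentiableAt two_ne_zero)
    rw [mfderiv_eq_fderiv] at e1
    rw [e1]
    rw [hr, mfderivWithin_univ] at inv
    simp only [hr, mpullbackWithin_apply, mfderivWithin_univ]
    exact congrArg (mfderiv 𝓘(ℝ, E) 𝓘(ℝ, F) h (φ.symm y)) (inv.self_apply_inverse _)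
  have hfd : ∀ y, MDifferentiableAt 𝓘(ℝ, E) 𝓘(ℝ, F) f y := hf.mdifferentiable two_ne_zero
  -- the left-hand side in the chart
  have inv := isInvertible_mfderiv_extChartAt (I := 𝓘(ℝ, E)) (mem_extChartAt_source (I := 𝓘(ℝ, E)) x)
  have dg : ContDiffAt ℝ 2 (f ∘ φ.symm) (φ x) :=
    (ContMDiffAt.comp (φ x) hf.contMDiffAt (hsymm _ hx)).contDiffAt
  have lhs : dirDeriv f x (mlieBracket 𝓘(ℝ, E) V W x) =
      fderiv ℝ (f ∘ φ.symm) (φ x) (lieBracket ℝ V' W' (φ x)) := by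
    have e : (f ∘ φ.symm) ∘ φ =ᶠ[𝓝 x] f := by
      filter_upwards [extChartAt_source_mem_nhds (I := 𝓘(ℝ, E)) x] with y hy
      simp only [Function.comp_apply]
      rw [φ.left_inv hy]
    have dg' : MDifferentiableAt 𝓘(ℝ, E) 𝓘(ℝ, F) (f ∘ φ.symm) (φ x) :=
      (ContMDiffAt.comp (φ x) hf.contMDiffAt (hsymm _ hx)).mdifferentiableAt two_ne_zero
    have e1 : mfderiv 𝓘(ℝ, E) 𝓘(ℝ, F) ((f ∘ φ.symm) ∘ φ) x = _ :=
      mfderiv_comp (I' := 𝓘(ℝ, E)) x dg'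
        (mdifferentiableAt_extChartAt (I := 𝓘(ℝ, E)) (mem_chart_source E x))
    rw [e.mfderiv_eq, mfderiv_eq_fderiv] at e1
    have e2 : mlieBracket 𝓘(ℝ, E) V W x =
        (mfderiv 𝓘(ℝ, E) 𝓘(ℝ, E) φ x).inverse (show E from lieBracket ℝ V' W' (φ x)) := by
      rw [← mlieBracketWithin_univ, mlieBracketWithin_apply, ← lieBracketWithin_univ, hr,
        Set.preimage_univ, Set.univ_inter, ← hr]
    unfold dirDeriv
    rw [e1, e2]
    exact congrArg (fderiv ℝ (f ∘ φ.symm) (φ x)) (inv.self_apply_inverse _)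
  have pt : ∀ (Z : Π x : M, TangentSpace 𝓘(ℝ, E) x),
      (fun y ↦ fderiv ℝ (f ∘ φ.symm) y
        (mpullbackWithin 𝓘(ℝ, E) 𝓘(ℝ, E) φ.symm Z (Set.range 𝓘(ℝ, E)) y)) =ᶠ[𝓝 (φ x)]
        (fun y ↦ dirDeriv f y (Z y)) ∘ φ.symm := fun Z ↦ by
    filter_upwards [tgt] with y hy
    exact chain f y hy (hfd _) Z
  have r1 := chain (fun y ↦ dirDeriv f y (W y)) _ hx (by rwa [hsx]) V
  have r2 := chain (fun y ↦ dirDeriv f y (V y)) _ hx (by rwa [hsx]) W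
  rw [← (pt W).fderiv_eq, hsx] at r1
  rw [← (pt V).fderiv_eq, hsx] at r2
  rw [lhs, ← r1, ← r2]
  exact fderiv_apply_lieBracket dg (by simp) dW dV

end Commutator

/-! ### Smooth and analytic vectors of a representation `U` of `G` by unitary operators on `ℋ`

`G` is a Lie group modelled on the finite-dimensional real vector space `E`. Differentiability of
maps `G → ℋ` is understood over `ℝ`. -/

section Vectors

set_option linter.unusedSectionVars false

variable (E : Type*) [NormedAddCommGroup E] [NormedSpace ℝ E]
  {G : Type*} [Group G] [TopologicalSpace G] [ChartedSpace E G]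
  {ℋ : Type*} [NormedAddCommGroup ℋ] [InnerProductSpace ℂ ℋ]
  (U : G →* (ℋ ≃ₗᵢ[ℂ] ℋ))

/-- The orbit map `g ↦ U(g) v`. -/
def orbitMap (v : ℋ) : G → ℋ := fun g ↦ U g v

/-- The space of all `v` whose orbit map is of class `C^n`, where `n` is a natural number, `∞`
(smooth) or `ω` (real analytic). -/
def vectorsOfClass (n : ℕ∞ω) : Submodule ℂ ℋ where
  carrier := {v | ContMDiff 𝓘(ℝ, E) 𝓘(ℝ, ℋ) n (orbitMap U v)}
  add_mem' {v w} hv hw := by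
    have : orbitMap U (v + w) = orbitMap U v + orbitMap U w := by ext; simp [orbitMap]
    simpa only [Set.mem_ofPred_eq, this] using hv.add hw
  zero_mem' := by
    have : orbitMap U 0 = fun _ ↦ 0 := by ext; simp [orbitMap]
    simpa only [Set.mem_ofPred_eq, this] using contMDiff_const
  smul_mem' c v hv := by
    have : orbitMap U (c • v) =
        ((c • ContinuousLinearMap.id ℂ ℋ).restrictScalars ℝ) ∘ orbitMap U v := by
      ext; simp [orbitMap]
    simpa only [Set.mem_ofPred_eq, this] using
      ((c • ContinuousLinearMap.id ℂ ℋ).restrictScalars ℝ).contMDiff.comp hv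

/-- The space `ℋ^∞` of smooth vectors, as a subspace of `ℋ`. -/
def smoothVectors : Submodule ℂ ℋ := vectorsOfClass E U ∞

/-- The space `ℋ^ω` of analytic vectors, as a subspace of `ℋ`. -/
def analyticVectors : Submodule ℂ ℋ := vectorsOfClass E U ω

variable {E U} in
theorem dirDeriv_orbitMap_mul {v : ℋ} (hv : v ∈ smoothVectors E U) (g : G)
    (x : GroupLieAlgebra 𝓘(ℝ, E) G) :
    dirDeriv (fun h : G ↦ orbitMap U v (g * h)) 1 x = U g (dirDeriv (orbitMap U v) 1 x) := by
  let L : ℋ →L[ℝ] ℋ := ((U g).toContinuousLinearEquiv : ℋ →L[ℂ] ℋ).restrictScalars ℝ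
  have hv' : MDifferentiableAt 𝓘(ℝ, E) 𝓘(ℝ, ℋ) (orbitMap U v) (1 : G) :=
    ContMDiff.mdifferentiable hv (by simp) 1
  have h1 : (fun h : G ↦ orbitMap U v (g * h)) = L ∘ orbitMap U v := by
    ext h; simp [orbitMap, L]
  have e2 : mfderiv 𝓘(ℝ, E) 𝓘(ℝ, ℋ) (L ∘ orbitMap U v) 1 = _ :=
    mfderiv_comp (I' := 𝓘(ℝ, ℋ)) (1 : G) L.differentiableAt.mdifferentiableAt hv'
  rw [mfderiv_eq_fderiv, L.fderiv] at e2
  rw [h1]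
  exact congrArg (fun T : E →L[ℝ] ℋ ↦ T x) e2

/-- The space `ℋ^∞` of smooth vectors, as a type that carries its own (Fréchet) topology instead
of the topology induced by the norm of `ℋ`. -/
def SmoothVectors : Type _ := smoothVectors E U

namespace SmoothVectors

instance : AddCommGroup (SmoothVectors E U) := inferInstanceAs (AddCommGroup (smoothVectors E U))

instance : Module ℂ (SmoothVectors E U) := inferInstanceAs (Module ℂ (smoothVectors E U))

/-- The inclusion of `ℋ^∞` in `ℋ`. -/
def incl : SmoothVectors E U →ₗ[ℂ] ℋ := (smoothVectors E U).subtype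

variable {E U} in
theorem incl_mem (v : SmoothVectors E U) : incl E U v ∈ smoothVectors E U := v.2

variable {E U} in
theorem incl_injective : Function.Injective (incl E U) := Subtype.val_injective

end SmoothVectors

variable [FiniteDimensional ℝ E] [LieGroup 𝓘(ℝ, E) ω G]

variable {E U} in
theorem dirDeriv_orbitMap_apply {v : ℋ} (hv : v ∈ smoothVectors E U) (g : G)
    (x : GroupLieAlgebra 𝓘(ℝ, E) G) :
    dirDeriv (orbitMap U v) g (mulInvariantVectorField x g) =
      U g (dirDeriv (orbitMap U v) 1 x) := by
  have hv' : MDifferentiableAt 𝓘(ℝ, E) 𝓘(ℝ, ℋ) (orbitMap U v) (g * 1) :=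
    ContMDiff.mdifferentiable hv (by simp) _
  have hmul : MDifferentiableAt 𝓘(ℝ, E) 𝓘(ℝ, E) (fun h : G ↦ g * h) 1 :=
    (contMDiff_mul_left (I := 𝓘(ℝ, E)) (n := ω) (a := g)).mdifferentiable (by simp) 1
  have e1 : mfderiv 𝓘(ℝ, E) 𝓘(ℝ, ℋ) (orbitMap U v ∘ (fun h : G ↦ g * h)) 1 = _ :=
    mfderiv_comp (I' := 𝓘(ℝ, E)) (1 : G) hv' hmul
  have e4 : dirDeriv (orbitMap U v) (g * 1) (mfderiv 𝓘(ℝ, E) 𝓘(ℝ, E) (fun h : G ↦ g * h) 1 x) =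
      U g (dirDeriv (orbitMap U v) 1 x) :=
    (congrArg (fun T : E →L[ℝ] ℋ ↦ T x) e1).symm.trans (dirDeriv_orbitMap_mul hv g x)
  rw [← e4]
  unfold mulInvariantVectorField
  congr 1
  simp

theorem inTangentCoordinates_const (f : G → ℋ) (T : G → E →L[ℝ] ℋ) (g₀ g : G) :
    inTangentCoordinates 𝓘(ℝ, E) 𝓘(ℝ, ℋ) (fun _ : G ↦ (1 : G)) f T g₀ g = T g := by
  rw [inTangentCoordinates_eq (I := 𝓘(ℝ, E)) (I' := 𝓘(ℝ, ℋ)) (fun _ : G ↦ (1 : G)) f T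
    (mem_chart_source E (1 : G)) (Set.mem_univ (f g))]
  ext z
  simp only [ContinuousLinearMap.comp_apply, tangentBundleCore_coordChange_model_space]
  rw [(tangentBundleCore 𝓘(ℝ, E) G).coordChange_self _ _ (mem_chart_source _ _)]
  simp

variable {E U} in
theorem dirDeriv_orbitMap_mem {v : ℋ} (hv : v ∈ smoothVectors E U)
    (x : GroupLieAlgebra 𝓘(ℝ, E) G) :
    dirDeriv (orbitMap U v) 1 x ∈ smoothVectors E U := by
  intro g₀
  have hm : ContMDiff (𝓘(ℝ, E).prod 𝓘(ℝ, E)) 𝓘(ℝ, ℋ) ∞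
      (Function.uncurry (fun g h : G ↦ orbitMap U v (g * h))) :=
    ContMDiff.comp (I' := 𝓘(ℝ, E)) hv (contMDiff_mul 𝓘(ℝ, E) ∞)
  let x' : E := x
  have key := ContMDiffAt.mfderiv_apply (I := 𝓘(ℝ, E)) (I' := 𝓘(ℝ, ℋ)) (J := 𝓘(ℝ, E))
    (J' := 𝓘(ℝ, E)) (m := ∞) (n := ∞) (x₀ := g₀)
    (fun g h : G ↦ orbitMap U v (g * h))
    (fun _ : G ↦ (1 : G)) (fun g : G ↦ g) (fun _ : G ↦ x') hm.contMDiffAt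
    contMDiffAt_const contMDiffAt_id contMDiffAt_const (by simp)
  refine key.congr_of_eventuallyEq (Filter.Eventually.of_forall fun g ↦ ?_)
  exact (dirDeriv_orbitMap_mul hv g x).symm.trans
    (congrArg (fun T : E →L[ℝ] ℋ ↦ T x') (inTangentCoordinates_const E (fun g ↦ orbitMap U v (g * 1))
      (fun g ↦ mfderiv 𝓘(ℝ, E) 𝓘(ℝ, ℋ) (fun h : G ↦ orbitMap U v (g * h)) 1) g₀ g)).symm

variable {E U} in
theorem orbitMap_dirDeriv {v : ℋ} (hv : v ∈ smoothVectors E U)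
    (x : GroupLieAlgebra 𝓘(ℝ, E) G) :
    orbitMap U (dirDeriv (orbitMap U v) 1 x) =
      fun g ↦ dirDeriv (orbitMap U v) g (mulInvariantVectorField x g) :=
  funext fun g ↦ (dirDeriv_orbitMap_apply hv g x).symm

namespace SmoothVectors

variable {E U} in
theorem mdifferentiable_orbitMap (v : SmoothVectors E U) :
    MDifferentiable 𝓘(ℝ, E) 𝓘(ℝ, ℋ) (orbitMap U (incl E U v)) :=
  ContMDiff.mdifferentiable (incl_mem v) (by simp)

/-- `dU(x) v`, the derivative at `1` of the orbit map `g ↦ U(g) v` in the direction `x`; by the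
chain rule it is the derivative at `t = 0` of `U(γ(t)) v` for every curve `γ` in `G` with `γ(0) = 1`
and `γ´(0) = x`, such as `γ(t) = exp(t x)`. -/
def dU (x : GroupLieAlgebra 𝓘(ℝ, E) G) : Module.End ℂ (SmoothVectors E U) where
  toFun v := ⟨dirDeriv (orbitMap U (incl E U v)) 1 x, dirDeriv_orbitMap_mem (incl_mem v) x⟩
  map_add' v w := by
    apply incl_injective
    have h : orbitMap U (incl E U (v + w)) =
        orbitMap U (incl E U v) + orbitMap U (incl E U w) := by
      ext g; simp [orbitMap]
    have e := congrArg (fun T : E →L[ℝ] ℋ ↦ T x) (mfderiv_add (mdifferentiable_orbitMap v (1 : G))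
      (mdifferentiable_orbitMap w (1 : G)))
    exact (congrArg (fun f : G → ℋ ↦ dirDeriv f 1 x) h).trans e
  map_smul' c v := by
    apply incl_injective
    let L : ℋ →L[ℝ] ℋ := (c • ContinuousLinearMap.id ℂ ℋ).restrictScalars ℝ
    have h : orbitMap U (incl E U (c • v)) = L ∘ orbitMap U (incl E U v) := by
      ext g; simp [orbitMap, L]
    have e : mfderiv 𝓘(ℝ, E) 𝓘(ℝ, ℋ) (L ∘ orbitMap U (incl E U v)) 1 = _ :=
      mfderiv_comp (I' := 𝓘(ℝ, ℋ)) (1 : G) L.differentiableAt.mdifferentiableAt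
        (mdifferentiable_orbitMap v (1 : G))
    rw [mfderiv_eq_fderiv, L.fderiv] at e
    exact (congrArg (fun f : G → ℋ ↦ dirDeriv f 1 x) h).trans
      (congrArg (fun T : E →L[ℝ] ℋ ↦ T x) e)

variable {E U} in
theorem incl_dU (x : GroupLieAlgebra 𝓘(ℝ, E) G) (v : SmoothVectors E U) :
    incl E U (dU E U x v) = dirDeriv (orbitMap U (incl E U v)) 1 x := rfl

section Enveloping

attribute [local instance 100] LieRing.ofAssociativeRing

/-- The representation `x ↦ dU(x)` of the Lie algebra of `G` on `ℋ^∞`. -/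
def dULie : GroupLieAlgebra 𝓘(ℝ, E) G →ₗ⁅ℝ⁆ Module.End ℂ (SmoothVectors E U) where
  toFun := dU E U
  map_add' x y := by
    ext v
    apply incl_injective
    rw [LinearMap.add_apply, map_add, incl_dU, incl_dU, incl_dU]
    exact map_add (mfderiv 𝓘(ℝ, E) 𝓘(ℝ, ℋ) (orbitMap U (incl E U v)) 1 : E →L[ℝ] ℋ) x y
  map_smul' r x := by
    ext v
    apply incl_injective
    change dirDeriv (orbitMap U (incl E U v)) 1 (r • x) = incl E U ((r : ℂ) • dU E U x v)
    rw [map_smul, incl_dU]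
    exact map_smul (mfderiv 𝓘(ℝ, E) 𝓘(ℝ, ℋ) (orbitMap U (incl E U v)) 1 : E →L[ℝ] ℋ) r x
  map_lie' {x y} := by
    ext v
    apply incl_injective
    rw [LieRing.of_associative_ring_bracket, LinearMap.sub_apply, map_sub, Module.End.mul_apply,
      Module.End.mul_apply, incl_dU, incl_dU, incl_dU, incl_dU, incl_dU,
      orbitMap_dirDeriv (incl_mem v), orbitMap_dirDeriv (incl_mem v), GroupLieAlgebra.bracket_def]
    have hs : ∀ z : GroupLieAlgebra 𝓘(ℝ, E) G, MDifferentiableAt 𝓘(ℝ, E) 𝓘(ℝ, ℋ)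
        (fun g ↦ dirDeriv (orbitMap U (incl E U v)) g (mulInvariantVectorField z g)) 1 := by
      intro z
      rw [← orbitMap_dirDeriv (incl_mem v)]
      exact mdifferentiable_orbitMap (dU E U z v) 1
    have hi : IsManifold 𝓘(ℝ, E) 2 G := inferInstance
    have h2 : (2 : ℕ∞ω) ≤ ∞ := ENat.LEInfty.out
    have := dirDeriv_mlieBracket (ContMDiff.of_le (incl_mem v) h2)
      (mdifferentiableAt_mulInvariantVectorField x) (mdifferentiableAt_mulInvariantVectorField y)
      (hs x) (hs y)
    have one : ∀ z : GroupLieAlgebra 𝓘(ℝ, E) G, mulInvariantVectorField z (1 : G) = z := by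
      intro z
      have h1 : (fun g : G ↦ 1 * g) = id := by ext; simp
      unfold mulInvariantVectorField
      rw [h1, mfderiv_id]
      rfl
    rw [one, one] at this
    exact this

/-- The extension of `dU` to a representation of the enveloping algebra on `ℋ^∞`. -/
def dUEnv : UniversalEnvelopingAlgebra ℝ (GroupLieAlgebra 𝓘(ℝ, E) G) →ₐ[ℝ]
    Module.End ℂ (SmoothVectors E U) :=
  UniversalEnvelopingAlgebra.lift ℝ (dULie E U)

end Enveloping

/-- The seminorms `v ↦ ‖dU(D) v‖`, where `D` runs through the enveloping algebra. -/
def seminorms : SeminormFamily ℂ (SmoothVectors E U)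
    (UniversalEnvelopingAlgebra ℝ (GroupLieAlgebra 𝓘(ℝ, E) G)) :=
  fun D ↦ (normSeminorm ℂ ℋ).comp (incl E U ∘ₗ dUEnv E U D)

/-- The Fréchet topology of `ℋ^∞`. -/
instance : TopologicalSpace (SmoothVectors E U) :=
  (seminorms E U).moduleFilterBasis.topology

theorem withSeminorms : WithSeminorms (seminorms E U) := ⟨rfl⟩

end SmoothVectors

end Vectors

end

end UnitaryLieRep

/-! Smooth vectors are regularised by functions of a Laplacian. Let Δ = ∑ dU(x i)² for a basis x i
of the Lie algebra and let T = (1 - Δ)⁻¹, obtained without unbounded operators: let V be the closed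
span of the gradients (v, dU(x 1) v, …, dU(x n) v) of smooth vectors and P the orthogonal projection
onto V. The components of P (v, 0, …, 0) are T v and, for smooth v, the dU(x i) T v
(`gradComp_smoothResolvent`).

The key point is that P moves analytically under conjugation. The diagonal representation W, twisted
by matrices M(g) of the adjoint action, preserves V, so W(g) P W(g)⁻¹ has the same range as M(g⁻¹) P
M(g). The latter is visibly analytic in g, and an algebraic identity recovers the orthogonal
projection from it (`mul_add_star_sub_one`, `isOperatorOfClass_gradProj`). Hence the conjugates by
U(g) of T and of the other components of P (·, 0, …, 0) are analytic in operator norm.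

This has two uses. First, for v in the closure of the smooth vectors the derivative of U(g) T v is
R(g) U(g) v with R analytic near 1. If v k = T (v (k + 1)) with geometric growth, iteration yields
Cauchy estimates, so v 0 is analytic (`mem_analyticVectors_of_forall_resolvent_eq`). This applies to
χ(T) v when χ vanishes near 0, with v k = T⁻ᵏ χ(T) v. Second, T maps ℋ^∞ onto itself, since v = T (v
- Δ v), and every D in the enveloping algebra satisfies D Tᵐ = K on ℋ^∞ for some m and some bounded
K (`isResolventBounded`). Writing v = Tᵐ T u gives D (χ(T) v - v) = K (χ(T) T u - T u), which is
small when χ differs from 1 only near 0. -/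

namespace UnitaryLieRep

noncomputable section

/-! ### Real analyticity and Cauchy estimates -/

section AnalyticFunctions

variable {E : Type*} [NormedAddCommGroup E] [NormedSpace ℝ E]
  {F : Type*} [NormedAddCommGroup F] [NormedSpace ℝ F] [CompleteSpace F]

open scoped Nat NNReal ENNReal

/-- Cauchy estimates, locally uniform in the point, for a real analytic function. -/
theorem exists_norm_iteratedFDeriv_le_of_analyticAt {f : E → F} {x : E} (hf : AnalyticAt ℝ f x) :
    ∃ C c : ℝ, 0 ≤ C ∧ 0 < c ∧ ∀ᶠ y in 𝓝 x, ∀ n, ‖iteratedFDeriv ℝ n f y‖ ≤ C * c ^ n * n ! := by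
  obtain ⟨p, R, hp⟩ := hf
  obtain ⟨q, hq0, hqR⟩ := ENNReal.lt_iff_exists_nnreal_btwn.1 hp.r_pos
  have hq0' : 0 < q := by exact_mod_cast hq0
  -- Half of `q`, so that moving the centre by less than `r` still leaves a radius `r` inside the
  -- disc of convergence.
  set r : ℝ≥0 := q / 2 with hr
  have hr0 : 0 < r := half_pos hq0'
  have hrr : ((r : ℝ≥0∞) + r) < p.radius := by
    refine lt_of_lt_of_le ?_ hp.r_le
    rw [← ENNReal.coe_add, hr, add_halves]
    exact hqR
  have hsum := p.changeOriginSeries_summable_aux₁ hrr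
  set S := ∑' s : Σ k l : ℕ, { s : Finset (Fin (k + l)) // s.card = l },
    ‖p (s.1 + s.2.1)‖₊ * r ^ s.2.1 * r ^ s.1 with hS
  -- For fixed `n` the coefficient at the new centre is bounded by a subsum of one convergent
  -- multiple series, whose sum `S` depends neither on `z` nor on `n`.
  have key : ∀ z : E, ‖z‖₊ < r → ∀ n, ‖p.changeOrigin z n‖₊ * r ^ n ≤ S := by
    intro z hz n
    have hzr : (‖z‖₊ : ℝ≥0∞) < p.radius := by
      refine lt_of_lt_of_le ?_ hrr.le
      refine lt_of_lt_of_le (by exact_mod_cast hz) (le_add_right le_rfl)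
    have hrp : (r : ℝ≥0∞) < p.radius := lt_of_le_of_lt (le_add_right le_rfl) hrr
    calc ‖p.changeOrigin z n‖₊ * r ^ n
        ≤ (∑' s : Σ l : ℕ, { s : Finset (Fin (n + l)) // s.card = l },
            ‖p (n + s.1)‖₊ * ‖z‖₊ ^ s.1) * r ^ n := by
          gcongr; exact p.nnnorm_changeOrigin_le n hzr
      _ ≤ (∑' s : Σ l : ℕ, { s : Finset (Fin (n + l)) // s.card = l },
            ‖p (n + s.1)‖₊ * r ^ s.1) * r ^ n := by
          gcongr ?_ * _
          refine Summable.tsum_le_tsum (fun s ↦ ?_) (p.changeOriginSeries_summable_aux₂ hzr n)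
            (p.changeOriginSeries_summable_aux₂ hrp n)
          gcongr
      _ = ∑' s : Σ l : ℕ, { s : Finset (Fin (n + l)) // s.card = l },
            ‖p (n + s.1)‖₊ * r ^ s.1 * r ^ n := by rw [NNReal.tsum_mul_right]
      _ ≤ S := by
          have hinj : Function.Injective (fun s : Σ l : ℕ,
              { s : Finset (Fin (n + l)) // s.card = l } ↦
              (⟨n, s⟩ : Σ k l : ℕ, { s : Finset (Fin (k + l)) // s.card = l })) :=
            fun a b h ↦ eq_of_heq (Sigma.mk.inj h).2
          have := NNReal.tsum_comp_le_tsum_of_inj hsum hinj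
          simpa only [Function.comp_def] using this
  refine ⟨S, (r : ℝ)⁻¹, S.2, inv_pos.2 hr0, ?_⟩
  filter_upwards [Metric.ball_mem_nhds x (show (0 : ℝ) < r from hr0)] with y hy n
  have hz : ‖y - x‖₊ < r := by
    rw [← NNReal.coe_lt_coe, coe_nnnorm, ← dist_eq_norm]; exact hy
  have hyR : (‖y - x‖₊ : ℝ≥0∞) < R := by
    refine lt_trans (show (‖y - x‖₊ : ℝ≥0∞) < r by exact_mod_cast hz) (lt_trans ?_ hqR)
    exact_mod_cast NNReal.half_lt_self hq0'.ne'
  have h1 := hp.changeOrigin hyR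
  rw [add_sub_cancel] at h1
  have hk : ‖p.changeOrigin (y - x) n‖ ≤ S * (r : ℝ)⁻¹ ^ n := by
    have := key _ hz n
    rw [inv_pow, ← div_eq_mul_inv, le_div_iff₀ (by positivity)]
    exact_mod_cast this
  refine ContinuousMultilinearMap.opNorm_le_bound (by positivity) fun v ↦ ?_
  -- The derivative is the sum of the coefficient over all permutations of its arguments; this is
  -- where `n !` comes from.
  rw [h1.iteratedFDeriv_eq_sum_of_completeSpace]
  refine (norm_sum_le_of_le _ (f := fun _ : Equiv.Perm (Fin n) ↦ _) fun σ _ ↦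
    ((p.changeOrigin (y - x) n).le_opNorm _).trans
      (le_of_eq (congrArg _ (Equiv.prod_comp σ fun i ↦ ‖v i‖)))).trans ?_
  rw [Finset.sum_const, Finset.card_univ, Fintype.card_perm, Fintype.card_fin, nsmul_eq_mul]
  calc (n ! : ℝ) * (‖p.changeOrigin (y - x) n‖ * ∏ i, ‖v i‖)
      ≤ n ! * ((S * (r : ℝ)⁻¹ ^ n) * ∏ i, ‖v i‖) := by gcongr
    _ = _ := by ring

/-- A smooth function whose derivatives satisfy Cauchy estimates is real analytic. -/
theorem analyticAt_of_norm_iteratedFDeriv_le {f : E → F} {x : E} {C c : ℝ} (hC : 0 ≤ C)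
    (hc : 0 < c) (hf : ∀ᶠ y in 𝓝 x, ContDiffAt ℝ ∞ f y)
    (hb : ∀ᶠ y in 𝓝 x, ∀ n, ‖iteratedFDeriv ℝ n f y‖ ≤ C * c ^ n * n !) : AnalyticAt ℝ f x := by
  obtain ⟨δ, hδ, hball⟩ := Metric.eventually_nhds_iff_ball.1 (hf.and hb)
  -- Inside radius `δ` the estimates hold, and inside `(2 * c)⁻¹` the Taylor series is dominated by
  -- a geometric series of ratio at most 1/2.
  set r : ℝ≥0 := ⟨min δ (2 * c)⁻¹, by positivity⟩ with hr
  have hr0 : 0 < r := NNReal.coe_lt_coe.1 (lt_min hδ (by positivity))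
  have hrδ : (r : ℝ) ≤ δ := min_le_left _ _
  have hrc : (r : ℝ) ≤ (2 * c)⁻¹ := min_le_right _ _
  let p : FormalMultilinearSeries ℝ E F := fun n ↦ (n ! : ℝ)⁻¹ • iteratedFDeriv ℝ n f x
  have hpn : ∀ n, ‖p n‖ ≤ C * c ^ n := fun n ↦ by
    have := (hball x (Metric.mem_ball_self hδ)).2 n
    simp only [p]
    rw [norm_smul, norm_inv, RCLike.norm_natCast, inv_mul_le_iff₀ (by positivity)]
    linarith
  have hcr : c * r ≤ 1 / 2 := by
    calc c * r ≤ c * (2 * c)⁻¹ := by gcongr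
      _ = 1 / 2 := by field_simp
  refine ⟨p, r, ⟨?_, by exact_mod_cast hr0, ?_⟩⟩
  · refine p.le_radius_of_bound C fun n ↦ ?_
    calc ‖p n‖ * (r : ℝ) ^ n ≤ C * c ^ n * r ^ n := by gcongr; exact hpn n
      _ = C * (c * r) ^ n := by ring
      _ ≤ C * 1 := by gcongr; exact pow_le_one₀ (by positivity) (by linarith)
      _ = C := mul_one C
  · intro y hy
    have hyr : ‖y‖ < r := by
      rw [Metric.mem_eball, edist_zero_right] at hy
      have : ‖y‖ₑ < (r : ℝ≥0∞) := hy
      rw [enorm_eq_nnnorm] at this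
      exact_mod_cast this
    have hcy : c * ‖y‖ ≤ 1 / 2 := le_trans (by gcongr) hcr
    have hpy : ∀ n, ‖p n fun _ ↦ y‖ ≤ C * (c * ‖y‖) ^ n := fun n ↦ by
      calc ‖p n fun _ ↦ y‖ ≤ ‖p n‖ * ‖y‖ ^ n := by
            simpa using (p n).le_opNorm fun _ ↦ y
        _ ≤ C * c ^ n * ‖y‖ ^ n := by gcongr; exact hpn n
        _ = _ := by ring
    have hsum : Summable fun n ↦ p n fun _ ↦ y := by
      refine Summable.of_norm_bounded ?_ hpy
      exact (summable_geometric_of_lt_one (by positivity) (by linarith)).mul_left C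
    rw [hsum.hasSum_iff_tendsto_nat, ← Filter.tendsto_add_atTop_iff_nat 1]
    have hmem : ∀ t ∈ Set.Icc (0 : ℝ) 1, x + t • y ∈ Metric.ball x δ := by
      intro t ht
      rw [mem_ball_iff_norm, add_sub_cancel_left, norm_smul, Real.norm_of_nonneg ht.1]
      nlinarith [ht.1, ht.2, norm_nonneg y]
    -- Integral form of the Taylor remainder. The factor `(1 - t) ^ n` is bounded crudely by 1, so
    -- `(n + 1)! / n !` leaves a factor `n + 1`, harmless against the geometric decay.
    have hrem : ∀ n : ℕ, ‖∑ i ∈ Finset.range (n + 1), (p i fun _ ↦ y) - f (x + y)‖ ≤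
        C * ((n + 1 : ℕ) * (c * ‖y‖) ^ (n + 1)) := by
      intro n
      have ht := map_add_eq_sum_add_integral_iteratedFDeriv (f := f) (x := x) (y := y) (n := n)
        fun t ht ↦ (hball _ (hmem t ht)).1.of_le (by exact_mod_cast le_top)
      have hi : ‖∫ t in (0 : ℝ)..1, (1 - t) ^ n •
          iteratedFDeriv ℝ (n + 1) f (x + t • y) (fun _ ↦ y)‖ ≤
          (C * c ^ (n + 1) * (n + 1)! * ‖y‖ ^ (n + 1)) * |(1 : ℝ) - 0| := by
        refine intervalIntegral.norm_integral_le_of_norm_le_const fun t ht ↦ ?_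
        rw [Set.uIoc_of_le zero_le_one] at ht
        have ht' : t ∈ Set.Icc (0 : ℝ) 1 := ⟨ht.1.le, ht.2⟩
        have h1 : ‖(1 - t) ^ n‖ ≤ 1 := by
          rw [norm_pow, Real.norm_of_nonneg (by linarith [ht.2])]
          exact pow_le_one₀ (by linarith [ht.2]) (by linarith [ht.1])
        have h2 : ‖iteratedFDeriv ℝ (n + 1) f (x + t • y) fun _ ↦ y‖ ≤
            C * c ^ (n + 1) * (n + 1)! * ‖y‖ ^ (n + 1) := by
          refine le_trans (ContinuousMultilinearMap.le_opNorm _ _) ?_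
          simp only [Finset.prod_const, Finset.card_univ, Fintype.card_fin]
          gcongr
          exact (hball _ (hmem t ht')).2 (n + 1)
        rw [norm_smul]
        calc _ ≤ 1 * (C * c ^ (n + 1) * (n + 1)! * ‖y‖ ^ (n + 1)) := by gcongr
          _ = _ := one_mul _
      rw [ht, ← norm_neg]
      have e : -(∑ i ∈ Finset.range (n + 1), (p i fun _ ↦ y) -
          (∑ k ∈ Finset.range (n + 1), (k ! : ℝ)⁻¹ • (iteratedFDeriv ℝ k f x fun _ ↦ y) +
          (n ! : ℝ)⁻¹ • ∫ t in (0 : ℝ)..1, (1 - t) ^ n •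
            iteratedFDeriv ℝ (n + 1) f (x + t • y) fun _ ↦ y)) =
          (n ! : ℝ)⁻¹ • ∫ t in (0 : ℝ)..1, (1 - t) ^ n •
            iteratedFDeriv ℝ (n + 1) f (x + t • y) fun _ ↦ y := by
        simp only [p, smul_apply]
        abel
      rw [e, norm_smul, norm_inv, RCLike.norm_natCast, inv_mul_le_iff₀ (by positivity)]
      refine hi.trans (le_of_eq ?_)
      rw [Nat.factorial_succ]
      push_cast
      rw [sub_zero, abs_one]
      ring
    rw [tendsto_iff_norm_sub_tendsto_zero]
    refine squeeze_zero (fun _ ↦ norm_nonneg _) hrem ?_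
    have := ((tendsto_self_mul_const_pow_of_lt_one (r := c * ‖y‖) (by positivity)
      (by linarith)).const_mul C)
    rw [mul_zero] at this
    exact (Filter.tendsto_add_atTop_iff_nat 1).2 this

/-- The members of a sequence of bounded functions of geometric growth, each of which is an
antiderivative of the next one up to an analytic operator valued factor, are analytic. -/
theorem analyticAt_of_forall_hasFDerivAt {R : E → F →L[ℝ] E →L[ℝ] F} {f : ℕ → E → F} {x : E}
    {C r : ℝ} (hC : 0 ≤ C) (hr : 1 ≤ r) (hR : AnalyticAt ℝ R x)
    (hf : ∀ᶠ y in 𝓝 x, ∀ k, HasFDerivAt (f k) (R y (f (k + 1) y)) y)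
    (hb : ∀ᶠ y in 𝓝 x, ∀ k, ‖f k y‖ ≤ C * r ^ k) : AnalyticAt ℝ (f 0) x := by
  obtain ⟨K, c, hK, hc, hRb⟩ := exists_norm_iteratedFDeriv_le_of_analyticAt hR
  obtain ⟨δ, hδ, hball⟩ := Metric.eventually_nhds_iff_ball.1
    ((hf.and hb).and (hRb.and hR.eventually_analyticAt))
  set s := Metric.ball x δ with hs
  have hso : IsOpen s := Metric.isOpen_ball
  have hxs : x ∈ s := Metric.mem_ball_self hδ
  have hRs : ContDiffOn ℝ ∞ R s := fun y hy ↦ (hball y hy).2.2.contDiffAt.contDiffWithinAt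
  have hfd : ∀ k, ∀ y ∈ s, fderiv ℝ (f k) y = R y (f (k + 1) y) := fun k y hy ↦
    ((hball y hy).1.1 k).fderiv
  have hfs : ∀ (n : ℕ) k, ContDiffOn ℝ n (f k) s := by
    intro n
    induction n with
    | zero =>
      intro k
      exact contDiffOn_zero.2 fun y hy ↦ ((hball y hy).1.1 k).continuousAt.continuousWithinAt
    | succ n ih =>
      intro k
      have : ((n + 1 : ℕ) : ℕ∞ω) = (n : ℕ∞ω) + 1 := by simp
      rw [this, contDiffOn_succ_iff_fderiv_of_isOpen hso]
      refine ⟨fun y hy ↦ ((hball y hy).1.1 k).differentiableAt.differentiableWithinAt, by simp, ?_⟩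
      exact ((hRs.of_le (by exact_mod_cast le_top)).clm_apply (ih (k + 1))).congr (hfd k)
  -- The summand `2 * c` turns the Leibniz sum into a geometric one of ratio 1/2; `2 * K` absorbs
  -- the bound `K` on the factor `R` times the value 2 of that geometric series.
  set A : ℝ := 2 * c + 2 * K with hA
  have hA0 : 0 < A := by positivity
  -- The induction on `n` must treat all `k` at once, because each differentiation replaces `f k` by
  -- `f (k + 1)`; hence the exponent `k + n`.
  have bound : ∀ n k, ∀ y ∈ s, ‖iteratedFDerivWithin ℝ n (f k) s y‖ ≤
      C * A ^ n * r ^ (k + n) * n ! := by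
    intro n
    induction n using Nat.strong_induction_on with
    | _ n ih =>
    intro k y hy
    rcases n with _ | n
    · simpa using (hball y hy).1.2 k
    have e1 : Set.EqOn (fderivWithin ℝ (f k) s) (fun y ↦ R y (f (k + 1) y)) s := fun y hy ↦ by
      rw [fderivWithin_of_isOpen hso hy, hfd k y hy]
    rw [← norm_iteratedFDerivWithin_fderivWithin hso.uniqueDiffOn hy,
      iteratedFDerivWithin_congr e1 hy]
    refine (norm_iteratedFDerivWithin_clm_apply (hRs.of_le (m := n) (by exact_mod_cast le_top))
      (hfs n (k + 1)) hso.uniqueDiffOn hy le_rfl).trans ?_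
    have term : ∀ i ∈ Finset.range (n + 1), (n.choose i : ℝ) * ‖iteratedFDerivWithin ℝ i R s y‖ *
        ‖iteratedFDerivWithin ℝ (n - i) (f (k + 1)) s y‖ ≤
        (K * C * n ! * A ^ n * r ^ (k + (n + 1))) * (1 / 2) ^ i := by
      intro i hi
      have hin : i ≤ n := Nat.lt_succ_iff.1 (Finset.mem_range.1 hi)
      have b1 : ‖iteratedFDerivWithin ℝ i R s y‖ ≤ K * c ^ i * i ! := by
        rw [iteratedFDerivWithin_of_isOpen i hso hy]; exact (hball y hy).2.1 i
      have b2 := ih (n - i) (by omega) (k + 1) y hy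
      have b3 : r ^ (k + 1 + (n - i)) ≤ r ^ (k + (n + 1)) := pow_le_pow_right₀ hr (by omega)
      have b4 : c ^ i ≤ A ^ i * (1 / 2) ^ i := by
        rw [← mul_pow]; gcongr; rw [hA]; linarith
      have b5 : (n.choose i : ℝ) * i ! * (n - i)! = n ! := by
        exact_mod_cast Nat.choose_mul_factorial_mul_factorial hin
      have b6 : A ^ i * A ^ (n - i) = A ^ n := by rw [← pow_add]; congr 1; omega
      calc _ ≤ (n.choose i : ℝ) * (K * (A ^ i * (1 / 2) ^ i) * i !) *
            (C * A ^ (n - i) * r ^ (k + (n + 1)) * (n - i)!) := by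
            refine mul_le_mul (mul_le_mul_of_nonneg_left (b1.trans ?_) (by positivity))
              (b2.trans ?_) (norm_nonneg _) (by positivity)
            · gcongr
            · gcongr
        _ = _ := by rw [← b5, ← b6]; ring
    refine (Finset.sum_le_sum term).trans ?_
    rw [← Finset.mul_sum]
    have geo : ∑ i ∈ Finset.range (n + 1), ((1 : ℝ) / 2) ^ i ≤ 2 := by
      refine (Summable.sum_le_tsum _ (fun _ _ ↦ by positivity) summable_geometric_two).trans ?_
      rw [tsum_geometric_two]
    calc _ ≤ (K * C * n ! * A ^ n * r ^ (k + (n + 1))) * 2 := by gcongr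
      _ = C * (A ^ n * (2 * K)) * r ^ (k + (n + 1)) * n ! := by ring
      _ ≤ C * (A ^ n * A) * r ^ (k + (n + 1)) * (n + 1)! := by
        gcongr
        · rw [hA]; linarith
        · omega
      _ = _ := by rw [pow_succ]
  refine analyticAt_of_norm_iteratedFDeriv_le (C := C) (c := A * r) hC (by positivity) ?_ ?_
  · filter_upwards [hso.mem_nhds hxs] with y hy
    exact (contDiffOn_infty.2 fun n ↦ hfs n 0).contDiffAt (hso.mem_nhds hy)
  · filter_upwards [hso.mem_nhds hxs] with y hy n
    have := bound n 0 y hy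
    rw [iteratedFDerivWithin_of_isOpen n hso hy, zero_add] at this
    rwa [mul_pow, ← mul_assoc]

end AnalyticFunctions

/-! ### Derivatives of families of maps between manifolds -/

section Calculus

variable {E : Type*} [NormedAddCommGroup E] [NormedSpace ℝ E]
  {M : Type*} [TopologicalSpace M] [ChartedSpace E M]
  {E' : Type*} [NormedAddCommGroup E'] [NormedSpace ℝ E']
  {M' : Type*} [TopologicalSpace M'] [ChartedSpace E' M']
  {D : Type*} [NormedAddCommGroup D] [NormedSpace ℝ D]
  {N : Type*} [TopologicalSpace N] [ChartedSpace D N]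

/-- The derivative of a map of manifolds, as a linear map between the model spaces. -/
def modelDeriv (f : M → M') (a : M) : E →L[ℝ] E' :=
  mfderiv 𝓘(ℝ, E) 𝓘(ℝ, E') f a

/-- The derivative at a fixed point of a family of maps with a fixed value there depends smoothly on
the parameter. -/
theorem contMDiffAt_mfderiv_of_forall_eq {m n : ℕ∞ω} [IsManifold 𝓘(ℝ, D) 1 N]
    [IsManifold 𝓘(ℝ, E) n M]
    [IsManifold 𝓘(ℝ, E') n M'] {f : N → M → M'} {a : M} {b : M'} {x₀ : N}
    (hb : ∀ x, f x a = b)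
    (hf : ContMDiffAt (𝓘(ℝ, D).prod 𝓘(ℝ, E)) 𝓘(ℝ, E') n (Function.uncurry f) (x₀, a))
    (hmn : m + 1 ≤ n) :
    ContMDiffAt 𝓘(ℝ, D) 𝓘(ℝ, E →L[ℝ] E') m
      (fun x ↦ modelDeriv (E := E) (E' := E') (f x) a) x₀ := by
  have h1 : 1 ≤ n := le_trans (by simp) hmn
  have : IsManifold 𝓘(ℝ, E) 1 M := .of_le h1
  have : IsManifold 𝓘(ℝ, E') 1 M' := .of_le h1
  have key := ContMDiffAt.mfderiv (I := 𝓘(ℝ, E)) (I' := 𝓘(ℝ, E')) (J := 𝓘(ℝ, D)) (m := m)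
    (n := n) (x₀ := x₀) f (fun _ ↦ a) hf contMDiffAt_const hmn
  refine key.congr_of_eventuallyEq (Filter.Eventually.of_forall fun x ↦ ?_)
  -- Source and target base points are now constant, so the coordinate changes of the tangent
  -- bundles are identities.
  have hb' : (fun x ↦ f x a) = fun _ ↦ b := funext hb
  change modelDeriv (f x) a = inTangentCoordinates 𝓘(ℝ, E) 𝓘(ℝ, E') (fun _ : N ↦ a)
    (fun x ↦ f x a) (fun x ↦ modelDeriv (f x) a) x₀ x
  rw [hb', inTangentCoordinates_eq (I := 𝓘(ℝ, E)) (I' := 𝓘(ℝ, E')) (fun _ : N ↦ a) (fun _ ↦ b) _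
    (mem_chart_source E a) (mem_chart_source E' b)]
  ext z
  simp only [ContinuousLinearMap.comp_apply]
  rw [(tangentBundleCore 𝓘(ℝ, E) M).coordChange_self _ _ (mem_chart_source _ _),
    (tangentBundleCore 𝓘(ℝ, E') M').coordChange_self _ _ (mem_chart_source _ _)]

end Calculus

/-! ### Calculus on a Lie group near the unit element -/

section Calculus

variable {E : Type*} [NormedAddCommGroup E] [NormedSpace ℝ E]
  {G : Type*} [Group G] [TopologicalSpace G] [ChartedSpace E G]
  {F : Type*} [NormedAddCommGroup F] [NormedSpace ℝ F]

/-- The inverse of the preferred chart of a Lie group at the unit element. -/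
def unitParam (E : Type*) [NormedAddCommGroup E] [NormedSpace ℝ E]
    (G : Type*) [Group G] [TopologicalSpace G] [ChartedSpace E G] : E → G :=
  (extChartAt 𝓘(ℝ, E) (1 : G)).symm

/-- The coordinates of the unit element in the preferred chart there. -/
def unitCoord (E : Type*) [NormedAddCommGroup E] [NormedSpace ℝ E]
    (G : Type*) [Group G] [TopologicalSpace G] [ChartedSpace E G] : E :=
  extChartAt 𝓘(ℝ, E) (1 : G) 1

theorem contMDiffAt_one_iff {n : ℕ∞ω} {f : G → F} :
    ContMDiffAt 𝓘(ℝ, E) 𝓘(ℝ, F) n f 1 ↔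
      ContDiffAt ℝ n (fun y ↦ f (unitParam E G y)) (unitCoord E G) := by
  rw [contMDiffAt_iff_source, contMDiffWithinAt_iff_contDiffWithinAt]
  have hr : Set.range 𝓘(ℝ, E) = Set.univ := by simp
  rw [hr, contDiffWithinAt_univ]
  rfl

variable [LieGroup 𝓘(ℝ, E) ω G]

theorem eventually_contMDiffAt_unitParam :
    ∀ᶠ y in 𝓝 (unitCoord E G), ContMDiffAt 𝓘(ℝ, E) 𝓘(ℝ, E) ω (unitParam E G) y := by
  have tgt : (extChartAt 𝓘(ℝ, E) (1 : G)).target ∈ 𝓝 (unitCoord E G) :=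
    extChartAt_target_mem_nhds _
  filter_upwards [eventually_mem_nhds_iff.2 tgt] with y hy
  exact (contMDiffOn_extChartAt_symm (1 : G)).contMDiffAt hy

/-- A function on a Lie group that intertwines left translations with continuous linear maps is
`C^n` if it is so at the unit element. -/
theorem contMDiff_of_contMDiffAt_one {n : ℕ∞ω} {f : G → F} (L : G → F →L[ℝ] F)
    (hL : ∀ g h, f (g * h) = L g (f h)) (hf : ContMDiffAt 𝓘(ℝ, E) 𝓘(ℝ, F) n f 1) :
    ContMDiff 𝓘(ℝ, E) 𝓘(ℝ, F) n f := by
  intro g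
  have e : f = fun h ↦ L g (f (g⁻¹ * h)) := by
    ext h; rw [← hL, mul_inv_cancel_left]
  rw [e]
  have h1 : ContMDiffAt 𝓘(ℝ, E) 𝓘(ℝ, E) n (fun h : G ↦ g⁻¹ * h) g :=
    ((contMDiff_mul_left (I := 𝓘(ℝ, E)) (n := ω) (a := g⁻¹)).of_le le_top) g
  have h2 : ContMDiffAt 𝓘(ℝ, E) 𝓘(ℝ, F) n (fun h ↦ f (g⁻¹ * h)) g :=
    ContMDiffAt.comp_of_eq (I' := 𝓘(ℝ, E)) hf h1 (inv_mul_cancel g)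
  exact (L g).contMDiff.contMDiffAt.comp g h2

/-- The derivative of a smooth function along a left invariant vector field is smooth. -/
theorem contMDiff_dirDeriv_mul_left {f : G → F} (hf : ContMDiff 𝓘(ℝ, E) 𝓘(ℝ, F) ∞ f) (x : E) :
    ContMDiff 𝓘(ℝ, E) 𝓘(ℝ, F) ∞ fun g ↦
      modelDeriv (E := E) (E' := F) (fun h : G ↦ f (g * h)) 1 x := by
  intro g₀
  have hm : ContMDiff (𝓘(ℝ, E).prod 𝓘(ℝ, E)) 𝓘(ℝ, F) ∞
      (Function.uncurry (fun g h : G ↦ f (g * h))) :=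
    ContMDiff.comp (I' := 𝓘(ℝ, E)) hf (contMDiff_mul 𝓘(ℝ, E) ∞)
  have key := ContMDiffAt.mfderiv_apply (I := 𝓘(ℝ, E)) (I' := 𝓘(ℝ, F)) (J := 𝓘(ℝ, E))
    (J' := 𝓘(ℝ, E)) (m := ∞) (n := ∞) (x₀ := g₀)
    (fun g h : G ↦ f (g * h))
    (fun _ : G ↦ (1 : G)) (fun g : G ↦ g) (fun _ : G ↦ x) hm.contMDiffAt
    contMDiffAt_const contMDiffAt_id contMDiffAt_const (by simp)
  refine key.congr_of_eventuallyEq (Filter.Eventually.of_forall fun g ↦ ?_)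
  change modelDeriv (fun h : G ↦ f (g * h)) 1 x = inTangentCoordinates 𝓘(ℝ, E) 𝓘(ℝ, F)
    (fun _ : G ↦ (1 : G)) (fun g ↦ f (g * 1)) (fun g ↦ modelDeriv (fun h : G ↦ f (g * h)) 1)
    g₀ g x
  rw [inTangentCoordinates_eq (I := 𝓘(ℝ, E)) (I' := 𝓘(ℝ, F)) (fun _ : G ↦ (1 : G)) _ _
    (mem_chart_source E (1 : G)) (Set.mem_univ _)]
  simp only [ContinuousLinearMap.comp_apply, tangentBundleCore_coordChange_model_space]
  rw [(tangentBundleCore 𝓘(ℝ, E) G).coordChange_self _ _ (mem_chart_source _ _)]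
  simp

/-- The derivative at the unit element of the conjugation `h ↦ g⁻¹ h g`. -/
def adInv (g : G) : E →L[ℝ] E :=
  modelDeriv (fun h : G ↦ g⁻¹ * h * g) 1

theorem contMDiff_adInv_uncurry :
    ContMDiff (𝓘(ℝ, E).prod 𝓘(ℝ, E)) 𝓘(ℝ, E) ω
      (Function.uncurry fun g h : G ↦ g⁻¹ * h * g) := by
  have h1 : ContMDiff (𝓘(ℝ, E).prod 𝓘(ℝ, E)) 𝓘(ℝ, E) ω (fun p : G × G ↦ p.1) := contMDiff_fst
  have h2 : ContMDiff (𝓘(ℝ, E).prod 𝓘(ℝ, E)) 𝓘(ℝ, E) ω (fun p : G × G ↦ p.2) := contMDiff_snd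
  exact (h1.inv.mul h2).mul h1

theorem contMDiff_adInv :
    ContMDiff 𝓘(ℝ, E) 𝓘(ℝ, E →L[ℝ] E) ω (adInv : G → E →L[ℝ] E) := fun g ↦
  contMDiffAt_mfderiv_of_forall_eq (n := ω) (f := fun g h : G ↦ g⁻¹ * h * g) (a := (1 : G))
    (b := (1 : G)) (fun x ↦ by simp) contMDiff_adInv_uncurry.contMDiffAt (by simp)

/-- The left Maurer-Cartan form in the preferred chart at the unit element. -/
def maurerCartan (E : Type*) [NormedAddCommGroup E] [NormedSpace ℝ E]
    (G : Type*) [Group G] [TopologicalSpace G] [ChartedSpace E G] (y : E) : E →L[ℝ] E :=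
  modelDeriv (fun z ↦ (unitParam E G y)⁻¹ * unitParam E G (y + z)) 0

/-- Differentiating in the increment `z` at 0, after translation back to the unit, fixes both base
points, so `contMDiffAt_mfderiv_of_forall_eq` applies. -/
theorem contDiffAt_maurerCartan : ContDiffAt ℝ ω (maurerCartan E G) (unitCoord E G) := by
  have h0 : ContMDiffAt 𝓘(ℝ, E) 𝓘(ℝ, E) ω (unitParam E G) (unitCoord E G) :=
    eventually_contMDiffAt_unitParam.self_of_nhds
  refine ContMDiffAt.contDiffAt (contMDiffAt_mfderiv_of_forall_eq (n := ω)
    (f := fun y z : E ↦ (unitParam E G y)⁻¹ * unitParam E G (y + z)) (a := (0 : E)) (b := (1 : G))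
    (fun y ↦ by simp) ?_ (by simp))
  have h1 : ContMDiff (𝓘(ℝ, E).prod 𝓘(ℝ, E)) 𝓘(ℝ, E) ω (fun p : E × E ↦ p.1) := contMDiff_fst
  have h2 : ContMDiff (𝓘(ℝ, E).prod 𝓘(ℝ, E)) 𝓘(ℝ, E) ω (fun p : E × E ↦ p.1 + p.2) :=
    contMDiff_fst.add contMDiff_snd
  have h3 : ContMDiffAt (𝓘(ℝ, E).prod 𝓘(ℝ, E)) 𝓘(ℝ, E) ω
      (fun p : E × E ↦ unitParam E G p.1) (unitCoord E G, 0) :=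
    ContMDiffAt.comp_of_eq (I' := 𝓘(ℝ, E)) h0 h1.contMDiffAt rfl
  have h4 : ContMDiffAt (𝓘(ℝ, E).prod 𝓘(ℝ, E)) 𝓘(ℝ, E) ω
      (fun p : E × E ↦ unitParam E G (p.1 + p.2)) (unitCoord E G, 0) :=
    ContMDiffAt.comp_of_eq (I' := 𝓘(ℝ, E)) h0 h2.contMDiffAt (by simp)
  exact h3.inv.mul h4

end Calculus

/-! ### Derivatives of orbit maps -/

section Orbits

variable {E : Type*} [NormedAddCommGroup E] [NormedSpace ℝ E]
  {G : Type*} [Group G] [TopologicalSpace G] [ChartedSpace E G]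
  {ℋ : Type*} [NormedAddCommGroup ℋ] [InnerProductSpace ℂ ℋ]
  {U : G →* (ℋ ≃ₗᵢ[ℂ] ℋ)}

theorem mem_vectorsOfClass_of_contMDiffAt_one [LieGroup 𝓘(ℝ, E) ω G] {n : ℕ∞ω} {v : ℋ}
    (h : ContMDiffAt 𝓘(ℝ, E) 𝓘(ℝ, ℋ) n (orbitMap U v) 1) : v ∈ vectorsOfClass E U n :=
  contMDiff_of_contMDiffAt_one
    (fun g ↦ ((U g).toContinuousLinearEquiv : ℋ →L[ℂ] ℋ).restrictScalars ℝ)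
    (fun g h ↦ by simp [orbitMap]) h

variable [FiniteDimensional ℝ E] [LieGroup 𝓘(ℝ, E) ω G]

namespace SmoothVectors

/-- The action of the group on smooth vectors. -/
def act (g : G) (v : SmoothVectors E U) : SmoothVectors E U :=
  ⟨U g (incl E U v), by
    have e : orbitMap U (U g (incl E U v)) = orbitMap U (incl E U v) ∘ fun h ↦ h * g := by
      ext h; simp [orbitMap]
    change ContMDiff 𝓘(ℝ, E) 𝓘(ℝ, ℋ) ∞ _
    rw [e]
    exact ContMDiff.comp (I' := 𝓘(ℝ, E)) (incl_mem v)
      ((contMDiff_mul_right (I := 𝓘(ℝ, E)) (n := ω) (a := g)).of_le le_top)⟩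

omit [FiniteDimensional ℝ E] in
theorem incl_act (g : G) (v : SmoothVectors E U) : incl E U (act g v) = U g (incl E U v) := rfl

/-- The derivative `x ↦ dU(x) v` of the orbit map of a smooth vector at the unit element. -/
def dOrbit (v : SmoothVectors E U) : E →L[ℝ] ℋ :=
  modelDeriv (orbitMap U (incl E U v)) (1 : G)

/-- The chain rule for the composition of a translated orbit map with a map that takes the value
`1`. -/
theorem hasMFDerivAt_comp {M : Type*} {E' : Type*} [NormedAddCommGroup E'] [NormedSpace ℝ E']
    [TopologicalSpace M] [ChartedSpace E' M] (v : SmoothVectors E U) (g : G) {φ : M → G} {a : M}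
    (hφ : MDifferentiableAt 𝓘(ℝ, E') 𝓘(ℝ, E) φ a) (ha : φ a = 1) :
    HasMFDerivAt 𝓘(ℝ, E') 𝓘(ℝ, ℋ) (fun z ↦ U g (U (φ z) (incl E U v))) a
      ((((U g).toContinuousLinearEquiv : ℋ →L[ℂ] ℋ).restrictScalars ℝ).comp
        ((dOrbit v).comp (modelDeriv φ a : E' →L[ℝ] E)) : E' →L[ℝ] ℋ) := by
  let L : ℋ →L[ℝ] ℋ := ((U g).toContinuousLinearEquiv : ℋ →L[ℂ] ℋ).restrictScalars ℝ
  have h1 : HasMFDerivAt 𝓘(ℝ, E) 𝓘(ℝ, ℋ) (orbitMap U (incl E U v)) (φ a)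
      (dOrbit v : E →L[ℝ] ℋ) := by
    rw [ha]; exact (mdifferentiable_orbitMap v (1 : G)).hasMFDerivAt
  have h2 := h1.comp a hφ.hasMFDerivAt
  have h3 : HasMFDerivAt 𝓘(ℝ, ℋ) 𝓘(ℝ, ℋ) L ((orbitMap U (incl E U v) ∘ φ) a) L :=
    L.hasFDerivAt.hasMFDerivAt
  exact h3.comp a h2

/-- Differentiate U(z) U(g) v = U(g) U(g⁻¹ z g) v at z = 1. -/
theorem dOrbit_act (g : G) (v : SmoothVectors E U) (x : E) :
    dOrbit (act g v) x = U g (dOrbit v (adInv g x)) := by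
  have hc : ContMDiff 𝓘(ℝ, E) 𝓘(ℝ, E) ω (fun h : G ↦ g⁻¹ * h * g) :=
    (contMDiff_const.mul contMDiff_id).mul contMDiff_const
  have h := hasMFDerivAt_comp v g (φ := fun h : G ↦ g⁻¹ * h * g) (a := (1 : G))
    (hc.mdifferentiable (by simp) 1) (by simp)
  have e : (fun z ↦ U g (U (g⁻¹ * z * g) (incl E U v))) = orbitMap U (incl E U (act g v)) := by
    ext z
    simp [orbitMap, incl_act]
  rw [e] at h
  exact congrArg (fun T : E →L[ℝ] ℋ ↦ T x) h.mfderiv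

/-- The neighbourhood is the same for all `v`, as needed for the later passage to limits of smooth
vectors. -/
theorem eventually_hasFDerivAt_orbit :
    ∀ᶠ y in 𝓝 (unitCoord E G), ∀ v : SmoothVectors E U,
      HasFDerivAt (fun z ↦ U (unitParam E G z) (incl E U v))
        ((((U (unitParam E G y)).toContinuousLinearEquiv : ℋ →L[ℂ] ℋ).restrictScalars ℝ).comp
          ((dOrbit v).comp (maurerCartan E G y))) y := by
  filter_upwards [eventually_contMDiffAt_unitParam] with y hy v
  have hadd : ContMDiff 𝓘(ℝ, E) 𝓘(ℝ, E) ω (fun z : E ↦ y + z) := contMDiff_const.add contMDiff_id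
  have h1 : ContMDiffAt 𝓘(ℝ, E) 𝓘(ℝ, E) ω (fun z : E ↦ unitParam E G (y + z)) 0 :=
    ContMDiffAt.comp_of_eq (I' := 𝓘(ℝ, E)) hy hadd.contMDiffAt (by simp)
  have h2 : ContMDiffAt 𝓘(ℝ, E) 𝓘(ℝ, E) ω
      (fun z : E ↦ (unitParam E G y)⁻¹ * unitParam E G (y + z)) 0 := contMDiffAt_const.mul h1
  have h := (hasMFDerivAt_comp v (unitParam E G y)
    (φ := fun z ↦ (unitParam E G y)⁻¹ * unitParam E G (y + z)) (a := (0 : E))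
    (h2.mdifferentiableAt (by simp)) (by simp)).hasFDerivAt
  have e : (fun z ↦ U (unitParam E G y) (U ((unitParam E G y)⁻¹ * unitParam E G (y + z))
      (incl E U v))) = fun z ↦ U (unitParam E G (y + z)) (incl E U v) := by
    ext z
    simp
  rw [e] at h
  have h' := (hasFDerivAt_comp_add_left (f := fun z ↦ U (unitParam E G z) (incl E U v)) y).1 h
  rwa [add_zero] at h'

end SmoothVectors

end Orbits

/-! ### Recovering an orthogonal projection from another operator with the same range -/

section Algebra

/-- If the left ideals of a self-adjoint idempotent `p` and of an idempotent `q` are such that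
`p q = q` and `q p = p`, then `p` can be recovered from `q`. -/
theorem mul_add_star_sub_one {A : Type*} [Ring A] [StarRing A] {p q : A} (hp : star p = p)
    (hpq : p * q = q) (hqp : q * p = p) : p * (q + star q - 1) = q := by
  have h : p * star q = p := by
    have := congrArg star hqp
    rwa [star_mul, hp] at this
  rw [mul_sub, mul_add, hpq, h, mul_one, add_sub_cancel_right]

variable {D : Type*} [NormedAddCommGroup D] [NormedSpace ℝ D]
  {N : Type*} [TopologicalSpace N] [ChartedSpace D N]

/-- Units are open and inversion is analytic on them, so p = q w⁻¹ near `x`. -/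
theorem contMDiffAt_of_mul_eq {A : Type*} [NormedRing A] [NormedAlgebra ℝ A] [CompleteSpace A]
    {n : ℕ∞ω} {p q w : N → A} {x : N} (h : ∀ y, p y * w y = q y) (hx : w x * w x = 1)
    (hq : ContMDiffAt 𝓘(ℝ, D) 𝓘(ℝ, A) n q x) (hw : ContMDiffAt 𝓘(ℝ, D) 𝓘(ℝ, A) n w x) :
    ContMDiffAt 𝓘(ℝ, D) 𝓘(ℝ, A) n p x := by
  let u : Aˣ := ⟨w x, w x, hx, hx⟩
  have hi : ContMDiffAt 𝓘(ℝ, A) 𝓘(ℝ, A) n Ring.inverse (w x) :=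
    (contDiffAt_ringInverse ℝ u).contMDiffAt
  have h1 : ContMDiffAt 𝓘(ℝ, D) 𝓘(ℝ, A) n (fun y ↦ Ring.inverse (w y)) x := hi.comp x hw
  have h2 : ContMDiffAt 𝓘(ℝ, D) 𝓘(ℝ, A) n (fun y ↦ q y * Ring.inverse (w y)) x := by
    have hm : ContDiff ℝ n (fun z : A × A ↦ z.1 * z.2) := contDiff_mul
    exact hm.contMDiff.contMDiffAt.comp x (hq.prodMk_space h1)
  refine h2.congr_of_eventuallyEq ?_
  have hu : ∀ᶠ y in 𝓝 x, IsUnit (w y) :=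
    hw.continuousAt.eventually (Units.isOpen.mem_nhds u.isUnit)
  filter_upwards [hu] with y hy
  rw [← h, Ring.mul_inverse_cancel_right _ _ hy]

end Algebra

/-! ### Operators with smooth or analytic conjugates -/

section Conjugation

variable {G : Type*} [Group G]
  {ℋ : Type*} [NormedAddCommGroup ℋ] [InnerProductSpace ℂ ℋ]
  (U : G →* (ℋ ≃ₗᵢ[ℂ] ℋ))

/-- The unitary operator of a group element, as a bounded operator. -/
def repOp (g : G) : ℋ →L[ℂ] ℋ := (U g).toContinuousLinearEquiv

@[simp]
theorem repOp_apply (g : G) (v : ℋ) : repOp U g v = U g v := rfl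

theorem rep_inv_apply_apply (g : G) (v : ℋ) : U g⁻¹ (U g v) = v := by simp

theorem rep_apply_inv_apply (g : G) (v : ℋ) : U g (U g⁻¹ v) = v := by simp

theorem star_repOp [CompleteSpace ℋ] (g : G) : star (repOp U g) = repOp U g⁻¹ := by
  rw [ContinuousLinearMap.star_eq_adjoint]
  symm
  rw [ContinuousLinearMap.eq_adjoint_iff]
  intro x y
  rw [repOp_apply, repOp_apply, ← (U g).inner_map_map, rep_apply_inv_apply]

/-- Conjugation with the unitary operator of a group element. -/
def conjRep (g : G) : (ℋ →L[ℂ] ℋ) →L[ℝ] (ℋ →L[ℂ] ℋ) :=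
  ((ContinuousLinearMap.mul ℝ (ℋ →L[ℂ] ℋ)) (repOp U g)).comp
    ((ContinuousLinearMap.mul ℝ (ℋ →L[ℂ] ℋ)).flip (repOp U g⁻¹))

theorem conjRep_eq (g : G) (K : ℋ →L[ℂ] ℋ) : conjRep U g K = repOp U g * (K * repOp U g⁻¹) := rfl

theorem conjRep_apply (g : G) (K : ℋ →L[ℂ] ℋ) (v : ℋ) :
    conjRep U g K v = U g (K (U g⁻¹ v)) := rfl

theorem conjRep_apply_rep (g : G) (K : ℋ →L[ℂ] ℋ) (v : ℋ) :
    conjRep U g K (U g v) = U g (K v) := by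
  rw [conjRep_apply, rep_inv_apply_apply]

theorem conjRep_mul (g h : G) (K : ℋ →L[ℂ] ℋ) :
    conjRep U (g * h) K = conjRep U g (conjRep U h K) := by
  ext v
  simp [conjRep_apply]

theorem conjRep_mul_op (g : G) (K L : ℋ →L[ℂ] ℋ) :
    conjRep U g (K * L) = conjRep U g K * conjRep U g L := by
  ext v
  simp [conjRep_apply]

theorem conjRep_one (K : ℋ →L[ℂ] ℋ) : conjRep U 1 K = K := by
  ext v
  simp [conjRep_apply]

variable (E : Type*) [NormedAddCommGroup E] [NormedSpace ℝ E]
  [TopologicalSpace G] [ChartedSpace E G]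

/-- A bounded operator has class `C^n` if its conjugates with the operators of the representation
depend in a `C^n` way on the group element, with respect to the operator norm. -/
def IsOperatorOfClass (n : ℕ∞ω) (K : ℋ →L[ℂ] ℋ) : Prop :=
  ContMDiff 𝓘(ℝ, E) 𝓘(ℝ, ℋ →L[ℂ] ℋ) n fun g ↦ conjRep U g K

variable {E U}

theorem isOperatorOfClass_of_contMDiffAt_one [LieGroup 𝓘(ℝ, E) ω G] {n : ℕ∞ω} {K : ℋ →L[ℂ] ℋ}
    (h : ContMDiffAt 𝓘(ℝ, E) 𝓘(ℝ, ℋ →L[ℂ] ℋ) n (fun g ↦ conjRep U g K) 1) :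
    IsOperatorOfClass U E n K :=
  contMDiff_of_contMDiffAt_one (conjRep U) (fun g h ↦ conjRep_mul U g h K) h

namespace IsOperatorOfClass

variable {n : ℕ∞ω} {K L : ℋ →L[ℂ] ℋ}

theorem add (hK : IsOperatorOfClass U E n K) (hL : IsOperatorOfClass U E n L) :
    IsOperatorOfClass U E n (K + L) := by
  have e : (fun g ↦ conjRep U g (K + L)) = fun g ↦ conjRep U g K + conjRep U g L := by
    ext1 g; rw [map_add]
  unfold IsOperatorOfClass
  rw [e]
  exact ContMDiff.add hK hL

theorem const_smul (hK : IsOperatorOfClass U E n K) (c : ℝ) : IsOperatorOfClass U E n (c • K) := by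
  have e : (fun g ↦ conjRep U g (c • K)) = fun g ↦ c • conjRep U g K := by
    ext1 g; rw [map_smul]
  unfold IsOperatorOfClass
  rw [e]
  exact (contDiff_const_smul c).contMDiff.comp hK

theorem mul (hK : IsOperatorOfClass U E n K) (hL : IsOperatorOfClass U E n L) :
    IsOperatorOfClass U E n (K * L) := by
  have e : (fun g ↦ conjRep U g (K * L)) = fun g ↦ conjRep U g K * conjRep U g L := by
    ext1 g; rw [conjRep_mul_op]
  unfold IsOperatorOfClass
  rw [e]
  have hm : ContDiff ℝ n (fun z : (ℋ →L[ℂ] ℋ) × (ℋ →L[ℂ] ℋ) ↦ z.1 * z.2) := contDiff_mul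
  exact hm.contMDiff.comp (ContMDiff.prodMk_space hK hL)

theorem sum {ι : Type*} (s : Finset ι) {K : ι → ℋ →L[ℂ] ℋ}
    (hK : ∀ i ∈ s, IsOperatorOfClass U E n (K i)) : IsOperatorOfClass U E n (∑ i ∈ s, K i) := by
  have e : (fun g ↦ conjRep U g (∑ i ∈ s, K i)) = fun g ↦ ∑ i ∈ s, conjRep U g (K i) := by
    ext1 g; rw [map_sum]
  unfold IsOperatorOfClass
  rw [e]
  exact contMDiff_finsetSum hK

theorem one {n : ℕ∞ω} : IsOperatorOfClass U E n (1 : ℋ →L[ℂ] ℋ) := by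
  have e : (fun g ↦ conjRep U g (1 : ℋ →L[ℂ] ℋ)) = fun _ ↦ 1 := by
    ext1 g; ext1 v; simp [conjRep_apply]
  unfold IsOperatorOfClass
  rw [e]
  exact contMDiff_const

theorem pow {n : ℕ∞ω} {K : ℋ →L[ℂ] ℋ} (hK : IsOperatorOfClass U E n K) (m : ℕ) :
    IsOperatorOfClass U E n (K ^ m) := by
  induction m with
  | zero => rw [pow_zero]; exact .one
  | succ m ih => rw [pow_succ]; exact ih.mul hK

/-- Operators of class `C^n` preserve the vectors of class `C^n`. -/
theorem apply_mem (hK : IsOperatorOfClass U E n K) {v : ℋ} (hv : v ∈ vectorsOfClass E U n) :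
    K v ∈ vectorsOfClass E U n := by
  have e : orbitMap U (K v) = fun g ↦
      ContinuousLinearMap.restrictScalarsL ℂ ℋ ℋ ℝ ℝ (conjRep U g K) (orbitMap U v g) := by
    ext1 g
    exact (conjRep_apply_rep U g K v).symm
  change ContMDiff 𝓘(ℝ, E) 𝓘(ℝ, ℋ) n _
  rw [e]
  exact ((ContinuousLinearMap.restrictScalarsL ℂ ℋ ℋ ℝ ℝ).contMDiff.comp hK).clm_apply hv

end IsOperatorOfClass

end Conjugation

/-! ### Finite direct sums of copies of the representation -/

section Coordinates

variable {G : Type*} [Group G]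
  {ℋ : Type*} [NormedAddCommGroup ℋ] [InnerProductSpace ℂ ℋ]
  {I : Type*} [Fintype I]

/-- The diagonal representation on a finite direct sum of copies of `ℋ`. -/
def diagRep (I : Type*) [Fintype I] (U : G →* (ℋ ≃ₗᵢ[ℂ] ℋ)) :
    G →* (PiLp 2 (fun _ : I ↦ ℋ) ≃ₗᵢ[ℂ] PiLp 2 (fun _ : I ↦ ℋ)) where
  toFun g := LinearIsometryEquiv.piLpCongrRight 2 fun _ ↦ U g
  map_one' := by ext x i; simp
  map_mul' g h := by ext x i; simp

@[simp]
theorem diagRep_apply (U : G →* (ℋ ≃ₗᵢ[ℂ] ℋ)) (g : G) (x : PiLp 2 (fun _ : I ↦ ℋ)) (i : I) :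
    diagRep I U g x i = U g (x i) := rfl

/-- The `i`-th coordinate of an element of a direct sum. -/
def coordProj (i : I) : PiLp 2 (fun _ : I ↦ ℋ) →L[ℂ] ℋ := PiLp.proj 2 (fun _ : I ↦ ℋ) i

omit [Fintype I] in
@[simp]
theorem coordProj_apply (i : I) (x : PiLp 2 (fun _ : I ↦ ℋ)) : coordProj i x = x i := rfl

variable [DecidableEq I]

/-- The inclusion of `ℋ` as the `i`-th summand of a direct sum. -/
def coordEmbed (i : I) : ℋ →L[ℂ] PiLp 2 (fun _ : I ↦ ℋ) :=
  ((PiLp.continuousLinearEquiv 2 ℂ (fun _ : I ↦ ℋ)).symm : _ →L[ℂ] _) ∘L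
    ContinuousLinearMap.single ℂ (fun _ : I ↦ ℋ) i

omit [Fintype I] in
theorem coordEmbed_apply (i j : I) (v : ℋ) :
    coordEmbed i v j = if j = i then v else 0 := by
  change Pi.single (M := fun _ : I ↦ ℋ) i v j = _
  rw [Pi.single_apply]

theorem inner_coordEmbed_left (i : I) (v : ℋ) (x : PiLp 2 (fun _ : I ↦ ℋ)) :
    inner ℂ (coordEmbed i v) x = inner ℂ v (x i) := by
  rw [PiLp.inner_apply, Finset.sum_eq_single i]
  · rw [coordEmbed_apply, if_pos rfl]
  · intro j _ hj
    rw [coordEmbed_apply, if_neg hj, inner_zero_left]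
  · simp

/-- The operator on a direct sum of copies of `ℋ` given by a matrix of real numbers. -/
def matrixOp (A : I → I → ℝ) : PiLp 2 (fun _ : I ↦ ℋ) →L[ℂ] PiLp 2 (fun _ : I ↦ ℋ) :=
  ∑ i, ∑ j, A i j • (coordEmbed i ∘L coordProj j)

theorem matrixOp_apply (A : I → I → ℝ) (x : PiLp 2 (fun _ : I ↦ ℋ)) (i : I) :
    matrixOp A x i = ∑ j, A i j • x j := by
  have h : ∀ k j, (A k j • (coordEmbed k ∘L coordProj (ℋ := ℋ) j)) x i =
      if k = i then A i j • x j else 0 := by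
    intro k j
    change A k j • coordEmbed k (x j) i = _
    rw [coordEmbed_apply]
    by_cases hk : k = i
    · subst hk; simp
    · rw [if_neg (Ne.symm hk), if_neg hk, smul_zero]
  unfold matrixOp
  rw [← coordProj_apply i, sum_apply, map_sum]
  simp_rw [sum_apply, map_sum, coordProj_apply, h]
  rw [Finset.sum_eq_single i]
  · simp
  · intro k _ hk; simp [hk]
  · simp

theorem matrixOp_diagRep (U : G →* (ℋ ≃ₗᵢ[ℂ] ℋ)) (A : I → I → ℝ) (g : G)
    (x : PiLp 2 (fun _ : I ↦ ℋ)) : matrixOp A (diagRep I U g x) = diagRep I U g (matrixOp A x) := by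
  ext i
  rw [matrixOp_apply, diagRep_apply, matrixOp_apply, map_sum]
  refine Finset.sum_congr rfl fun j _ ↦ ?_
  rw [diagRep_apply]
  exact (((U g).toContinuousLinearEquiv : ℋ →L[ℂ] ℋ).restrictScalars ℝ).map_smul _ _ |>.symm

theorem contMDiff_smul_const {D : Type*} [NormedAddCommGroup D] [NormedSpace ℝ D]
    {N : Type*} [TopologicalSpace N] [ChartedSpace D N]
    {F : Type*} [NormedAddCommGroup F] [NormedSpace ℝ F] {n : ℕ∞ω} {f : N → ℝ}
    (hf : ContMDiff 𝓘(ℝ, D) 𝓘(ℝ, ℝ) n f) (c : F) :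
    ContMDiff 𝓘(ℝ, D) 𝓘(ℝ, F) n fun x ↦ f x • c :=
  (ContinuousLinearMap.toSpanSingleton ℝ c).contMDiff.comp hf

theorem contMDiff_matrixOp {D : Type*} [NormedAddCommGroup D] [NormedSpace ℝ D]
    {N : Type*} [TopologicalSpace N] [ChartedSpace D N] {n : ℕ∞ω} {A : N → I → I → ℝ}
    (hA : ∀ i j, ContMDiff 𝓘(ℝ, D) 𝓘(ℝ, ℝ) n fun x ↦ A x i j) :
    ContMDiff 𝓘(ℝ, D) 𝓘(ℝ, PiLp 2 (fun _ : I ↦ ℋ) →L[ℂ] PiLp 2 (fun _ : I ↦ ℋ)) n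
      fun x ↦ matrixOp (ℋ := ℋ) (A x) := by
  unfold matrixOp
  refine contMDiff_finsetSum fun i _ ↦ contMDiff_finsetSum fun j _ ↦ ?_
  exact contMDiff_smul_const (hA i j) _

end Coordinates

/-! ### Gradients of smooth vectors and the projection onto their closed span -/

section Gradient

variable (E : Type*) [NormedAddCommGroup E] [NormedSpace ℝ E] [FiniteDimensional ℝ E]
  {G : Type*} [Group G] [TopologicalSpace G] [ChartedSpace E G] [LieGroup 𝓘(ℝ, E) ω G]
  {ℋ : Type*} [NormedAddCommGroup ℋ] [InnerProductSpace ℂ ℋ]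
  (U : G →* (ℋ ≃ₗᵢ[ℂ] ℋ))

/-- The index set of the components of the gradient. -/
abbrev GradIndex : Type := Option (Fin (Module.finrank ℝ E))

/-- The components of the gradient of a smooth vector: the vector itself and its derivatives along
the members of a basis of the Lie algebra. -/
def gradComp : GradIndex E → SmoothVectors E U →ₗ[ℂ] ℋ
  | none => SmoothVectors.incl E U
  | some i => SmoothVectors.incl E U ∘ₗ SmoothVectors.dU E U (Module.finBasis ℝ E i)

/-- The gradient of a smooth vector, as an element of a direct sum of copies of `ℋ`. -/
def grad : SmoothVectors E U →ₗ[ℂ] PiLp 2 (fun _ : GradIndex E ↦ ℋ) :=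
  (WithLp.linearEquiv 2 ℂ (GradIndex E → ℋ)).symm.toLinearMap ∘ₗ LinearMap.pi (gradComp E U)

/-- The closed span of the gradients of smooth vectors. -/
def gradSpace : Submodule ℂ (PiLp 2 (fun _ : GradIndex E ↦ ℋ)) :=
  (LinearMap.range (grad E U)).topologicalClosure

/-- The matrix that expresses the gradient of `U(g) v` in terms of that of `v`. -/
def gradMatrix (g : G) : GradIndex E → GradIndex E → ℝ
  | none, none => 1
  | none, some _ => 0
  | some _, none => 0
  | some i, some j => (Module.finBasis ℝ E).coord j (adInv g (Module.finBasis ℝ E i))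

variable {E U}

open SmoothVectors

theorem grad_apply (v : SmoothVectors E U) (o : GradIndex E) : grad E U v o = gradComp E U o v :=
  rfl

theorem gradComp_none (v : SmoothVectors E U) : gradComp E U none v = incl E U v := rfl

theorem gradComp_some (v : SmoothVectors E U) (i : Fin (Module.finrank ℝ E)) :
    gradComp E U (some i) v = dOrbit v (Module.finBasis ℝ E i) := rfl

theorem grad_mem (v : SmoothVectors E U) : grad E U v ∈ gradSpace E U :=
  Submodule.le_topologicalClosure _ ⟨v, rfl⟩

omit [FiniteDimensional ℝ E] [LieGroup 𝓘(ℝ, E) ω G] in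
theorem adInv_one : (adInv (1 : G) : E →L[ℝ] E) = ContinuousLinearMap.id ℝ E := by
  have h : (fun h : G ↦ (1 : G)⁻¹ * h * 1) = id := by ext; simp
  unfold adInv modelDeriv
  rw [h]
  exact mfderiv_id

theorem contMDiff_gradMatrix (o p : GradIndex E) :
    ContMDiff 𝓘(ℝ, E) 𝓘(ℝ, ℝ) ω fun g : G ↦ gradMatrix E g o p := by
  rcases o with _ | i <;> rcases p with _ | j
  · exact contMDiff_const
  · exact contMDiff_const
  · exact contMDiff_const
  · let L := (LinearMap.toContinuousLinearMap ((Module.finBasis ℝ E).coord j)).comp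
      (ContinuousLinearMap.apply ℝ E (Module.finBasis ℝ E i))
    exact ContMDiff.comp (I' := 𝓘(ℝ, E →L[ℝ] E)) (g := L) L.contMDiff (contMDiff_adInv (G := G))

omit [LieGroup 𝓘(ℝ, E) ω G] in
theorem matrixOp_gradMatrix_one :
    matrixOp (ℋ := ℋ) (gradMatrix E (1 : G)) = 1 := by
  ext x o
  rw [matrixOp_apply, Fintype.sum_option]
  rcases o with _ | i
  · simp [gradMatrix]
  · simp only [gradMatrix, adInv_one, zero_smul, zero_add, ContinuousLinearMap.id_apply,
      Module.Basis.coord_apply, Module.Basis.repr_self]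
    rw [Finset.sum_eq_single i]
    · simp
    · intro j _ hj; simp [hj.symm]
    · simp

/-- This is `dOrbit_act` in a basis. It shows that W(g) M(g) preserves the span of the gradients,
although W(g) alone need not. -/
theorem diagRep_matrixOp_grad (g : G) (v : SmoothVectors E U) :
    diagRep (GradIndex E) U g (matrixOp (gradMatrix E g) (grad E U v)) = grad E U (act g v) := by
  ext o
  rw [diagRep_apply, matrixOp_apply, Fintype.sum_option]
  rcases o with _ | i
  · simp [gradMatrix, grad_apply, gradComp_none, incl_act]
  · rw [grad_apply (act g v), gradComp_some, dOrbit_act]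
    congr 1
    simp only [gradMatrix, zero_smul, zero_add, grad_apply, gradComp_some, Module.Basis.coord_apply]
    conv_rhs => rw [← (Module.finBasis ℝ E).sum_repr (adInv g (Module.finBasis ℝ E i)), map_sum]
    simp only [map_smul]

theorem eq_of_mem_gradSpace {F : Type*} [NormedAddCommGroup F] [NormedSpace ℂ F]
    {K L : PiLp 2 (fun _ : GradIndex E ↦ ℋ) →L[ℂ] F}
    (h : ∀ v, K (grad E U v) = L (grad E U v))
    {x : PiLp 2 (fun _ : GradIndex E ↦ ℋ)} (hx : x ∈ gradSpace E U) : K x = L x := by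
  have hx' : x ∈ closure (LinearMap.range (grad E U) : Set (PiLp 2 fun _ : GradIndex E ↦ ℋ)) := hx
  refine closure_minimal ?_ (isClosed_eq K.continuous L.continuous) hx'
  rintro _ ⟨v, rfl⟩
  exact h v

variable [CompleteSpace ℋ]

variable (E U) in
/-- The orthogonal projection onto the closed span of the gradients of smooth vectors. -/
def gradProj : PiLp 2 (fun _ : GradIndex E ↦ ℋ) →L[ℂ] PiLp 2 (fun _ : GradIndex E ↦ ℋ) :=
  haveI : CompleteSpace (gradSpace E U) := Submodule.topologicalClosure.completeSpace _
  (gradSpace E U).starProjection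

theorem gradProj_mem (x : PiLp 2 (fun _ : GradIndex E ↦ ℋ)) : gradProj E U x ∈ gradSpace E U :=
  haveI : CompleteSpace (gradSpace E U) := Submodule.topologicalClosure.completeSpace _
  (gradSpace E U).starProjection_apply_mem x

theorem gradProj_eq_self {x : PiLp 2 (fun _ : GradIndex E ↦ ℋ)} (hx : x ∈ gradSpace E U) :
    gradProj E U x = x :=
  haveI : CompleteSpace (gradSpace E U) := Submodule.topologicalClosure.completeSpace _
  Submodule.starProjection_eq_self_iff.2 hx

theorem inner_gradProj (x y : PiLp 2 (fun _ : GradIndex E ↦ ℋ)) :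
    inner ℂ (gradProj E U x) y = inner ℂ x (gradProj E U y) :=
  haveI : CompleteSpace (gradSpace E U) := Submodule.topologicalClosure.completeSpace _
  (gradSpace E U).inner_starProjection_left_eq_right x y

theorem star_gradProj : star (gradProj E U) = gradProj E U := by
  rw [ContinuousLinearMap.star_eq_adjoint]
  exact ((ContinuousLinearMap.eq_adjoint_iff _ _).2 inner_gradProj).symm

theorem gradProj_mul_self : gradProj E U * gradProj E U = gradProj E U := by
  ext1 x
  exact gradProj_eq_self (gradProj_mem x)

/-- The projection onto the span of the gradients depends analytically on the position. -/
theorem isOperatorOfClass_gradProj :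
    IsOperatorOfClass (diagRep (GradIndex E) U) E ω (gradProj E U) := by
  set W := diagRep (GradIndex E) U with hW
  set P := gradProj E U with hP
  let 𝔼 := PiLp 2 (fun _ : GradIndex E ↦ ℋ)
  let M : G → 𝔼 →L[ℂ] 𝔼 := fun g ↦ matrixOp (gradMatrix E g)
  let q : G → 𝔼 →L[ℂ] 𝔼 := fun g ↦ M g⁻¹ * (P * M g)
  have hMW : ∀ g h x, M g (W h x) = W h (M g x) := fun g h x ↦ matrixOp_diagRep U _ h x
  have hgrad : ∀ g v, W g (M g (grad E U v)) = grad E U (act g v) := diagRep_matrixOp_grad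
  have hPV : ∀ g v, P (W g (M g (grad E U v))) = W g (M g (grad E U v)) := fun g v ↦ by
    rw [hgrad]; exact gradProj_eq_self (grad_mem _)
  -- `h1` and `h2` say that `q g` and the conjugated projection act as left identities on each
  -- other, the hypotheses of `mul_add_star_sub_one`. Here W(g⁻¹) M(g⁻¹) keeps `gradSpace`
  -- invariant, so `P` drops out.
  have h1 : ∀ g, conjRep W g P * q g = q g := by
    intro g
    ext1 x
    change W g (P (W g⁻¹ (M g⁻¹ (P (M g x))))) = M g⁻¹ (P (M g x))
    have := eq_of_mem_gradSpace (K := P * (repOp W g⁻¹ * M g⁻¹)) (L := repOp W g⁻¹ * M g⁻¹)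
      (hPV g⁻¹) (gradProj_mem (M g x))
    change P (W g⁻¹ (M g⁻¹ (P (M g x)))) = W g⁻¹ (M g⁻¹ (P (M g x))) at this
    rw [this, rep_apply_inv_apply]
  have h2 : ∀ g, q g * conjRep W g P = conjRep W g P := by
    intro g
    ext1 x
    change M g⁻¹ (P (M g (W g (P (W g⁻¹ x))))) = W g (P (W g⁻¹ x))
    refine eq_of_mem_gradSpace (K := M g⁻¹ * (P * (M g * repOp W g))) (L := repOp W g) (fun v ↦ ?_)
      (gradProj_mem (W g⁻¹ x))
    change M g⁻¹ (P (M g (W g (grad E U v)))) = W g (grad E U v)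
    -- Inserting W(g) W(g⁻¹) reduces the cancellation of M(g⁻¹) against M(g) on gradients to that of
    -- the actions of g⁻¹ and g on smooth vectors.
    rw [hMW, hPV, ← rep_apply_inv_apply W g (M g⁻¹ _), ← hMW g⁻¹ g⁻¹, hMW, hgrad, hgrad]
    congr 2
    apply incl_injective
    rw [incl_act, incl_act, rep_inv_apply_apply]
  have hstar : ∀ g, star (conjRep W g P) = conjRep W g P := by
    intro g
    rw [conjRep_eq, star_mul, star_mul, star_repOp, star_repOp, inv_inv, star_gradProj, mul_assoc]
  have hM : ContMDiff 𝓘(ℝ, E) 𝓘(ℝ, 𝔼 →L[ℂ] 𝔼) ω M := contMDiff_matrixOp contMDiff_gradMatrix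
  have hM' : ContMDiff 𝓘(ℝ, E) 𝓘(ℝ, 𝔼 →L[ℂ] 𝔼) ω fun g ↦ M g⁻¹ :=
    ContMDiff.comp (I' := 𝓘(ℝ, E)) (g := M) hM (contMDiff_inv 𝓘(ℝ, E) ω)
  have hm : ContDiff ℝ ω (fun z : (𝔼 →L[ℂ] 𝔼) × (𝔼 →L[ℂ] 𝔼) ↦ z.1 * z.2) := contDiff_mul
  have hq : ContMDiff 𝓘(ℝ, E) 𝓘(ℝ, 𝔼 →L[ℂ] 𝔼) ω q :=
    hm.contMDiff.comp (hM'.prodMk_space (hm.contMDiff.comp (contMDiff_const.prodMk_space hM)))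
  have hs : ContMDiff 𝓘(ℝ, E) 𝓘(ℝ, 𝔼 →L[ℂ] 𝔼) ω fun g ↦ star (q g) := by
    let S : (𝔼 →L[ℂ] 𝔼) →L[ℝ] (𝔼 →L[ℂ] 𝔼) := (starL' ℝ : (𝔼 →L[ℂ] 𝔼) ≃L[ℝ] (𝔼 →L[ℂ] 𝔼))
    exact S.contMDiff.comp hq
  have hw : ContMDiff 𝓘(ℝ, E) 𝓘(ℝ, 𝔼 →L[ℂ] 𝔼) ω fun g ↦ q g + star (q g) - 1 :=
    (hq.add hs).sub contMDiff_const
  refine isOperatorOfClass_of_contMDiffAt_one (contMDiffAt_of_mul_eq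
    (fun g ↦ mul_add_star_sub_one (hstar g) (h1 g) (h2 g)) ?_ hq.contMDiffAt hw.contMDiffAt)
  -- At the unit element the factor to be inverted is 2 P - 1, a reflection, hence its own inverse.
  have hq1 : q 1 = P := by
    change M 1⁻¹ * (P * M 1) = P
    rw [inv_one]
    change matrixOp (gradMatrix E (1 : G)) * (P * matrixOp (gradMatrix E (1 : G))) = P
    rw [matrixOp_gradMatrix_one, one_mul, mul_one]
  rw [hq1, star_gradProj, ← hP]
  have hPP : P * P = P := gradProj_mul_self
  simp only [mul_sub, sub_mul, mul_add, add_mul, hPP, one_mul, mul_one]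
  abel

end Gradient

/-! ### The resolvent of the Laplacian -/

section Resolvent

variable (E : Type*) [NormedAddCommGroup E] [NormedSpace ℝ E] [FiniteDimensional ℝ E]
  {G : Type*} [Group G] [TopologicalSpace G] [ChartedSpace E G] [LieGroup 𝓘(ℝ, E) ω G]
  {ℋ : Type*} [NormedAddCommGroup ℋ] [InnerProductSpace ℂ ℋ]
  (U : G →* (ℋ ≃ₗᵢ[ℂ] ℋ))

open SmoothVectors

variable {E U} in
/-- The operators `dU(x)` are skew-symmetric. -/
theorem inner_dOrbit_left (v w : SmoothVectors E U) (x : E) :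
    inner ℂ (dOrbit v x) (incl E U w) = -inner ℂ (incl E U v) (dOrbit w x) := by
  have hv : HasMFDerivAt 𝓘(ℝ, E) 𝓘(ℝ, ℋ) (orbitMap U (incl E U v)) 1
      (dOrbit v : E →L[ℝ] ℋ) :=
    (mdifferentiable_orbitMap v (1 : G)).hasMFDerivAt
  have hw : HasMFDerivAt 𝓘(ℝ, E) 𝓘(ℝ, ℋ) (orbitMap U (incl E U w)) 1
      (dOrbit w : E →L[ℝ] ℋ) :=
    (mdifferentiable_orbitMap w (1 : G)).hasMFDerivAt
  have hp : HasMFDerivAt 𝓘(ℝ, E) 𝓘(ℝ, ℋ × ℋ)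
      (fun g : G ↦ (orbitMap U (incl E U v) g, orbitMap U (incl E U w) g)) 1
      ((dOrbit v).prod (dOrbit w) : E →L[ℝ] ℋ × ℋ) :=
    ⟨hv.1.prodMk hw.1, hv.2.prodMk hw.2⟩
  have hi : HasFDerivAt (fun p : ℋ × ℋ ↦ inner ℂ p.1 p.2) _
      (orbitMap U (incl E U v) (1 : G), orbitMap U (incl E U w) (1 : G)) :=
    HasFDerivAt.inner ℂ hasFDerivAt_fst hasFDerivAt_snd
  have h := hi.hasMFDerivAt.comp (1 : G) hp
  have e : (fun p : ℋ × ℋ ↦ inner ℂ p.1 p.2) ∘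
      (fun g : G ↦ (orbitMap U (incl E U v) g, orbitMap U (incl E U w) g)) =
      fun _ ↦ inner ℂ (incl E U v) (incl E U w) := by
    ext g; simp [orbitMap]
  rw [e] at h
  have h0 := hasMFDerivAt_unique h (hasMFDerivAt_const _ _)
  have h1 := congrArg (fun T : E →L[ℝ] ℂ ↦ T x) h0
  change fderivInnerCLM ℂ (orbitMap U (incl E U v) (1 : G), orbitMap U (incl E U w) (1 : G))
    (dOrbit v x, dOrbit w x) = 0 at h1
  rw [fderivInnerCLM_apply] at h1
  simp only [orbitMap, map_one] at h1
  exact eq_neg_of_add_eq_zero_right h1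

variable {E U} in
/-- The components of the elements of the closed span of the gradients are limits of smooth
vectors. -/
theorem apply_mem_closure_of_mem_gradSpace {x : PiLp 2 (fun _ : GradIndex E ↦ ℋ)}
    (hx : x ∈ gradSpace E U) (o : GradIndex E) :
    x o ∈ (smoothVectors E U).topologicalClosure := by
  have hc : IsClosed ((coordProj o : PiLp 2 (fun _ : GradIndex E ↦ ℋ) →L[ℂ] ℋ) ⁻¹'
      ((smoothVectors E U).topologicalClosure : Set ℋ)) :=
    (Submodule.isClosed_topologicalClosure _).preimage (coordProj o).continuous
  have hx' : x ∈ closure (LinearMap.range (grad E U) : Set (PiLp 2 fun _ : GradIndex E ↦ ℋ)) := hx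
  refine closure_minimal ?_ hc hx'
  rintro _ ⟨v, rfl⟩
  refine Submodule.le_topologicalClosure _ ?_
  rcases o with _ | i
  · exact incl_mem v
  · exact incl_mem (dU E U (Module.finBasis ℝ E i) v)

-- Skew-symmetry of dU(x i) survives in the limit: the component `some i` is the weak derivative of
-- the component `none`.
variable {E U} in
theorem inner_apply_some_of_mem_gradSpace {x : PiLp 2 (fun _ : GradIndex E ↦ ℋ)}
    (hx : x ∈ gradSpace E U) (i : Fin (Module.finrank ℝ E)) (w : SmoothVectors E U) :
    inner ℂ (incl E U w) (x (some i)) = -inner ℂ (gradComp E U (some i) w) (x none) := by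
  refine eq_of_mem_gradSpace (K := innerSL ℂ (incl E U w) ∘L coordProj (some i))
    (L := -(innerSL ℂ (gradComp E U (some i) w) ∘L coordProj none)) (fun v ↦ ?_) hx
  change inner ℂ (incl E U w) (dOrbit v _) = -inner ℂ (dOrbit w _) (incl E U v)
  rw [inner_dOrbit_left, neg_neg]

variable {E U} in
omit [FiniteDimensional ℝ E] [LieGroup 𝓘(ℝ, E) ω G] in
/-- An element of the closure of a subspace that is orthogonal to the subspace vanishes. -/
theorem eq_zero_of_mem_closure_of_inner_eq_zero {x : ℋ}
    (hx : x ∈ (smoothVectors E U).topologicalClosure)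
    (h : ∀ w : SmoothVectors E U, inner ℂ (incl E U w) x = 0) : x = 0 := by
  have hx' : x ∈ closure (smoothVectors E U : Set ℋ) := hx
  have : inner ℂ x x = 0 := by
    refine closure_minimal (t := {y | inner ℂ y x = 0}) (fun w hw ↦ h ⟨w, hw⟩)
      (isClosed_eq (by fun_prop) continuous_const) hx'
  exact inner_self_eq_zero.1 this

variable [CompleteSpace ℋ]

/-- The compositions of the resolvent of the Laplace operator `∑ i, dU(x i) ^ 2` at `1`
with the components of the gradient. -/
def gradResolvent (o : GradIndex E) : ℋ →L[ℂ] ℋ :=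
  coordProj o ∘L gradProj E U ∘L coordEmbed none

/-- The resolvent of the Laplace operator `∑ i, dU(x i) ^ 2` at `1`. -/
def resolvent : ℋ →L[ℂ] ℋ := gradResolvent E U none

variable {E U}

/-- Coordinate inclusions and projections intertwine `U` with the diagonal representation, so the
conjugates are images of those of `gradProj` under one fixed continuous linear map. -/
theorem isOperatorOfClass_gradResolvent (o : GradIndex E) :
    IsOperatorOfClass U E ω (gradResolvent E U o) := by
  let 𝔼 := PiLp 2 (fun _ : GradIndex E ↦ ℋ)
  let L : (𝔼 →L[ℂ] 𝔼) →L[ℝ] (ℋ →L[ℂ] ℋ) :=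
    ((ContinuousLinearMap.compL ℂ ℋ 𝔼 ℋ (coordProj o)) ∘L
      ((ContinuousLinearMap.compL ℂ ℋ 𝔼 𝔼).flip (coordEmbed none))).restrictScalars ℝ
  have h : (fun g ↦ conjRep U g (gradResolvent E U o)) =
      fun g ↦ L (conjRep (diagRep (GradIndex E) U) g (gradProj E U)) := by
    ext1 g
    ext1 v
    change U g (gradProj E U (coordEmbed none (U g⁻¹ v)) o) =
      U g (gradProj E U (diagRep (GradIndex E) U g⁻¹ (coordEmbed none v)) o)
    have e : coordEmbed none (U g⁻¹ v) = diagRep (GradIndex E) U g⁻¹ (coordEmbed none v) := by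
      ext p
      rw [diagRep_apply, coordEmbed_apply, coordEmbed_apply]
      split_ifs <;> simp
    rw [e]
  unfold IsOperatorOfClass
  rw [h]
  exact L.contMDiff.comp isOperatorOfClass_gradProj

theorem isOperatorOfClass_resolvent : IsOperatorOfClass U E ω (resolvent E U) :=
  isOperatorOfClass_gradResolvent none

theorem isSelfAdjoint_resolvent : IsSelfAdjoint (resolvent E U) := by
  rw [ContinuousLinearMap.isSelfAdjoint_iff_isSymmetric]
  intro x y
  change inner ℂ (gradProj E U (coordEmbed none x) none) y =
    inner ℂ x (gradProj E U (coordEmbed none y) none)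
  rw [← inner_coordEmbed_left, ← inner_gradProj, ← inner_conj_symm, ← inner_coordEmbed_left,
    inner_conj_symm]

theorem resolvent_mem_closure (v : ℋ) :
    resolvent E U v ∈ (smoothVectors E U).topologicalClosure :=
  apply_mem_closure_of_mem_gradSpace (gradProj_mem _) none

variable (E U) in
/-- The resolvent, as an operator on smooth vectors. -/
def smoothResolvent : Module.End ℂ (SmoothVectors E U) where
  toFun v := ⟨resolvent E U (incl E U v),
    IsOperatorOfClass.apply_mem (n := ∞) (isOperatorOfClass_resolvent.of_le le_top) (incl_mem v)⟩
  map_add' v w := by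
    apply incl_injective
    change resolvent E U (incl E U (v + w)) = _
    rw [map_add, map_add]
    rfl
  map_smul' c v := by
    apply incl_injective
    change resolvent E U (incl E U (c • v)) = _
    rw [map_smul, map_smul]
    rfl

theorem incl_smoothResolvent (v : SmoothVectors E U) :
    incl E U (smoothResolvent E U v) = resolvent E U (incl E U v) := rfl

/-- The projected vector has T v as its first component; the others are its weak derivatives. Since
T v is smooth, they agree with the true ones: both lie in the closure of the smooth vectors and have
the same inner products with these. -/
theorem gradComp_smoothResolvent (o : GradIndex E) (v : SmoothVectors E U) :
    gradComp E U o (smoothResolvent E U v) = gradResolvent E U o (incl E U v) := by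
  rcases o with _ | i
  · rfl
  set x := gradProj E U (coordEmbed none (incl E U v)) with hx
  have hxm : x ∈ gradSpace E U := gradProj_mem _
  have hm : gradComp E U (some i) (smoothResolvent E U v) - x (some i) ∈
      (smoothVectors E U).topologicalClosure :=
    Submodule.sub_mem _ (Submodule.le_topologicalClosure _
      (incl_mem (dU E U (Module.finBasis ℝ E i) (smoothResolvent E U v))))
      (apply_mem_closure_of_mem_gradSpace hxm _)
  refine sub_eq_zero.1 (eq_zero_of_mem_closure_of_inner_eq_zero hm fun w ↦ ?_)
  have h1 := inner_apply_some_of_mem_gradSpace hxm i w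
  have h2 := inner_dOrbit_left w (smoothResolvent E U v) (Module.finBasis ℝ E i)
  change inner ℂ (incl E U w) (x (some i)) =
    -inner ℂ (dOrbit w (Module.finBasis ℝ E i)) (incl E U (smoothResolvent E U v)) at h1
  change inner ℂ (incl E U w)
    (dOrbit (smoothResolvent E U v) (Module.finBasis ℝ E i) - x (some i)) = 0
  rw [inner_sub_right, h1, h2, neg_neg, sub_self]

theorem grad_smoothResolvent (v : SmoothVectors E U) :
    grad E U (smoothResolvent E U v) = gradProj E U (coordEmbed none (incl E U v)) := by
  ext o
  exact gradComp_smoothResolvent o v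

theorem inner_grad_smoothResolvent (v w : SmoothVectors E U) :
    inner ℂ (grad E U (smoothResolvent E U v)) (grad E U w) =
      inner ℂ (incl E U v) (incl E U w) := by
  rw [grad_smoothResolvent, inner_gradProj, gradProj_eq_self (grad_mem w), inner_coordEmbed_left]
  rfl

-- Integration by parts, with u = v - Δ v.
omit [CompleteSpace ℋ] in
theorem exists_inner_grad_eq (v : SmoothVectors E U) : ∃ u : SmoothVectors E U,
    ∀ w, inner ℂ (incl E U u) (incl E U w) = inner ℂ (grad E U v) (grad E U w) := by
  refine ⟨v - ∑ i, dU E U (Module.finBasis ℝ E i) (dU E U (Module.finBasis ℝ E i) v), fun w ↦ ?_⟩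
  rw [PiLp.inner_apply, Fintype.sum_option, map_sub, inner_sub_left, map_sum, sum_inner,
    sub_eq_add_neg, ← Finset.sum_neg_distrib]
  congr 1
  refine Finset.sum_congr rfl fun i _ ↦ ?_
  change -inner ℂ (dOrbit (dU E U (Module.finBasis ℝ E i) v) (Module.finBasis ℝ E i))
    (incl E U w) = _
  rw [inner_dOrbit_left, neg_neg]
  rfl

/-- Every smooth vector belongs to the range of the resolvent on smooth vectors. -/
theorem smoothResolvent_surjective : Function.Surjective (smoothResolvent E U) := by
  intro v
  obtain ⟨u, hu⟩ := exists_inner_grad_eq v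
  refine ⟨u, ?_⟩
  have h : ∀ w, inner ℂ (grad E U (smoothResolvent E U u - v)) (grad E U w) = 0 := by
    intro w
    rw [map_sub, inner_sub_left, inner_grad_smoothResolvent, hu, sub_self]
  -- Uniqueness for the weak equation: test with the difference itself; its gradient vanishes, and
  -- the vector is a component of its gradient.
  have h0 := inner_self_eq_zero.1 (h (smoothResolvent E U u - v))
  have h1 : incl E U (smoothResolvent E U u - v) = 0 := by
    rw [← gradComp_none, ← grad_apply, h0]; rfl
  rw [← sub_eq_zero]
  exact incl_injective (h1.trans (map_zero _).symm)

theorem smoothResolvent_pow_surjective (m : ℕ) : Function.Surjective (smoothResolvent E U ^ m) := by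
  rw [Module.End.coe_pow]
  exact smoothResolvent_surjective.iterate m

end Resolvent

/-! ### A criterion for analytic vectors -/

section AnalyticVectors

variable (E : Type*) [NormedAddCommGroup E] [NormedSpace ℝ E] [FiniteDimensional ℝ E]
  {G : Type*} [Group G] [TopologicalSpace G] [ChartedSpace E G] [LieGroup 𝓘(ℝ, E) ω G]
  {ℋ : Type*} [NormedAddCommGroup ℋ] [InnerProductSpace ℂ ℋ] [CompleteSpace ℋ]
  (U : G →* (ℋ ≃ₗᵢ[ℂ] ℋ))

open SmoothVectors

/-- The operator valued function `R` for which `R(y) U(y) v` is the derivative at `y` of the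
function `U(y) T v`, where `T` is the resolvent. -/
def orbitFactor (y : E) : ℋ →L[ℝ] E →L[ℝ] ℋ :=
  ∑ i, (ContinuousLinearMap.smulRightL ℝ E ℋ ((LinearMap.toContinuousLinearMap
    ((Module.finBasis ℝ E).coord i)).comp (maurerCartan E G y))).comp
    (ContinuousLinearMap.restrictScalarsL ℂ ℋ ℋ ℝ ℝ
      (conjRep U (unitParam E G y) (gradResolvent E U (some i))))

variable {E U}

theorem orbitFactor_apply (y : E) (v : ℋ) (e : E) :
    orbitFactor E U y v e = ∑ i, (Module.finBasis ℝ E).coord i (maurerCartan E G y e) •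
      conjRep U (unitParam E G y) (gradResolvent E U (some i)) v := by
  unfold orbitFactor
  rw [sum_apply, sum_apply]
  rfl

theorem contDiffAt_orbitFactor :
    ContDiffAt ℝ ω (orbitFactor E U) (unitCoord E G) := by
  unfold orbitFactor
  refine ContDiffAt.sum fun i _ ↦ ContDiffAt.clm_comp ?_ ?_
  · exact (ContinuousLinearMap.contDiff _).contDiffAt.comp _
      (contDiffAt_const.clm_comp contDiffAt_maurerCartan)
  · exact (ContinuousLinearMap.contDiff _).contDiffAt.comp _
      (contMDiffAt_one_iff.1 (isOperatorOfClass_gradResolvent (some i)).contMDiffAt)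

/-- U(y) dU(x i) T v is the conjugate of the bounded operator `gradResolvent` applied to U(y) v, so
the derivative is a bounded operator applied to the orbit of v, without loss of derivatives. -/
theorem eventually_hasFDerivAt_orbit_smoothResolvent :
    ∀ᶠ y in 𝓝 (unitCoord E G), ∀ v : SmoothVectors E U,
      HasFDerivAt (fun z ↦ U (unitParam E G z) (resolvent E U (incl E U v)))
        (orbitFactor E U y (U (unitParam E G y) (incl E U v))) y := by
  filter_upwards [eventually_hasFDerivAt_orbit (U := U)] with y hy v
  refine HasFDerivAt.congr_fderiv (hy (smoothResolvent E U v)) (Eq.symm ?_)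
  ext e
  rw [orbitFactor_apply]
  change _ = U (unitParam E G y) (dOrbit (smoothResolvent E U v) (maurerCartan E G y e))
  conv_rhs => rw [← (Module.finBasis ℝ E).sum_repr (maurerCartan E G y e), map_sum, map_sum]
  refine Finset.sum_congr rfl fun i _ ↦ ?_
  rw [conjRep_apply_rep, ← gradComp_smoothResolvent, gradComp_some, map_smul,
    Module.Basis.coord_apply]
  exact (((U (unitParam E G y)).toContinuousLinearEquiv : ℋ →L[ℂ] ℋ).restrictScalars ℝ).map_smul
    _ _ |>.symm

theorem eventually_norm_lt_add_one {X F : Type*} [TopologicalSpace X] [NormedAddCommGroup F]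
    {f : X → F} {x : X} (h : ContinuousAt f x) : ∀ᶠ y in 𝓝 x, ‖f y‖ < ‖f x‖ + 1 :=
  h.norm.eventually_lt_const (lt_add_one _)

/-- Approximate `v` by smooth vectors: `orbitFactor` is locally bounded and U is isometric, so the
derivatives converge uniformly on a ball. -/
theorem eventually_hasFDerivAt_orbit_resolvent :
    ∀ᶠ y in 𝓝 (unitCoord E G), ∀ v ∈ (smoothVectors E U).topologicalClosure,
      HasFDerivAt (fun z ↦ U (unitParam E G z) (resolvent E U v))
        (orbitFactor E U y (U (unitParam E G y) v)) y := by
  have hb : ∀ᶠ y in 𝓝 (unitCoord E G),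
      ‖orbitFactor E U y‖ < ‖orbitFactor E U (unitCoord E G)‖ + 1 :=
    eventually_norm_lt_add_one (F := ℋ →L[ℝ] E →L[ℝ] ℋ) (f := orbitFactor E U)
      contDiffAt_orbitFactor.continuousAt
  filter_upwards [((eventually_hasFDerivAt_orbit_smoothResolvent (U := U)).and hb).eventually_nhds]
    with y hy v hv
  obtain ⟨δ, hδ, hball⟩ := Metric.eventually_nhds_iff_ball.1 hy
  set C := ‖orbitFactor E U (unitCoord E G)‖ + 1 with hC
  have hC0 : 0 < C := by positivity
  obtain ⟨w, hw, hwv⟩ := mem_closure_iff_seq_limit.1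
    (show v ∈ closure (smoothVectors E U : Set ℋ) from hv)
  refine hasFDerivAt_of_tendstoUniformlyOn (l := Filter.atTop) Metric.isOpen_ball
    (f := fun n z ↦ U (unitParam E G z) (resolvent E U (w n)))
    (f' := fun n z ↦ orbitFactor E U z (U (unitParam E G z) (w n)))
    (g' := fun z ↦ orbitFactor E U z (U (unitParam E G z) v)) ?_
    (fun n z hz ↦ (hball z hz).1 ⟨w n, hw n⟩) (fun z _ ↦ ?_) (Metric.mem_ball_self hδ)
  · rw [Metric.tendstoUniformlyOn_iff]
    intro ε hε
    have h0 : ∀ᶠ n in Filter.atTop, dist (w n) v < ε / C :=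
      (Metric.tendsto_nhds.1 hwv) _ (by positivity)
    filter_upwards [h0] with n hn z hz
    rw [dist_eq_norm, ← map_sub, ← map_sub]
    calc ‖orbitFactor E U z (U (unitParam E G z) (v - w n))‖
        ≤ ‖orbitFactor E U z‖ * ‖U (unitParam E G z) (v - w n)‖ :=
          (orbitFactor E U z).le_opNorm _
      _ ≤ C * ‖v - w n‖ := by
          rw [LinearIsometryEquiv.norm_map]
          gcongr
          exact (hball z hz).2.le
      _ < C * (ε / C) := by
          gcongr
          rwa [dist_eq_norm, norm_sub_rev] at hn
      _ = ε := by field_simp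
  · exact (((U (unitParam E G z)).continuous.comp (resolvent E U).continuous).tendsto v).comp hwv

/-- A vector at which a sequence of bounds of geometric growth for the inverse powers of the
resolvent is available is analytic. -/
theorem mem_analyticVectors_of_forall_resolvent_eq {v : ℕ → ℋ} {C r : ℝ} (hC : 0 ≤ C) (hr : 1 ≤ r)
    (hv : ∀ k, resolvent E U (v (k + 1)) = v k) (hb : ∀ k, ‖v k‖ ≤ C * r ^ k) :
    v 0 ∈ analyticVectors E U := by
  have hR : AnalyticAt ℝ (orbitFactor E U) (unitCoord E G) :=
    contDiffAt_orbitFactor.analyticAt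
  refine mem_vectorsOfClass_of_contMDiffAt_one (contMDiffAt_one_iff.2 (AnalyticAt.contDiffAt
    (analyticAt_of_forall_hasFDerivAt (f := fun k y ↦ U (unitParam E G y) (v k)) hC hr hR ?_ ?_)))
  · filter_upwards [eventually_hasFDerivAt_orbit_resolvent (U := U)] with y hy k
    -- As v (k + 1) = T (v (k + 2)), it lies in the closure of the smooth vectors, where the
    -- derivative formula is valid.
    have h := hy (v (k + 1)) (hv (k + 1) ▸ resolvent_mem_closure _)
    rwa [hv] at h
  · exact Filter.Eventually.of_forall fun y k ↦ by
      rw [LinearIsometryEquiv.norm_map]; exact hb k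

end AnalyticVectors

/-! ### Scalar cutoff functions -/

section Cutoff

/-- A continuous function that vanishes for `|x| ≤ δ` and takes the value `1` for `2 δ ≤ |x|`. -/
def cutoff (δ x : ℝ) : ℝ := min 1 (max 0 (|x| / δ - 1))

/-- A continuous function that takes the value `x⁻¹` for `δ ≤ |x|`. -/
def truncInv (δ x : ℝ) : ℝ := x / max (x ^ 2) (δ ^ 2)

variable {δ : ℝ}

theorem continuous_cutoff : Continuous (cutoff δ) := by unfold cutoff; fun_prop

theorem continuous_truncInv (hδ : 0 < δ) : Continuous (truncInv δ) := by
  unfold truncInv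
  exact continuous_id.div (by fun_prop) fun x ↦ (lt_max_of_lt_right (by positivity)).ne'

theorem cutoff_nonneg (x : ℝ) : 0 ≤ cutoff δ x := le_min zero_le_one (le_max_left _ _)

theorem cutoff_le_one (x : ℝ) : cutoff δ x ≤ 1 := min_le_left _ _

theorem abs_truncInv_le (hδ : 0 < δ) (x : ℝ) : |truncInv δ x| ≤ δ⁻¹ := by
  have hm : 0 < max (x ^ 2) (δ ^ 2) := lt_max_of_lt_right (by positivity)
  unfold truncInv
  rw [abs_div, abs_of_pos hm, div_le_iff₀ hm, inv_mul_eq_div, le_div_iff₀ hδ]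
  rcases le_total |x| δ with h | h
  · refine le_trans ?_ (le_max_right _ _)
    rw [sq]
    gcongr
  · refine le_trans ?_ (le_max_left _ _)
    rw [← sq_abs, sq]
    gcongr

theorem mul_truncInv_mul_cutoff (hδ : 0 < δ) (x : ℝ) :
    x * (truncInv δ x * cutoff δ x) = cutoff δ x := by
  rcases le_total |x| δ with h | h
  · have : cutoff δ x = 0 := by
      unfold cutoff
      rw [max_eq_left, min_eq_right zero_le_one]
      rw [sub_nonpos, div_le_one hδ]
      exact h
    rw [this, mul_zero, mul_zero]
  · have hx : x ≠ 0 := fun h0 ↦ by rw [h0, abs_zero] at h; linarith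
    have h1 : δ ^ 2 ≤ x ^ 2 := by rw [← sq_abs x]; gcongr
    unfold truncInv
    rw [max_eq_left h1]
    field_simp

theorem abs_mul_cutoff_sub_one_le (hδ : 0 < δ) (x : ℝ) : |x * (cutoff δ x - 1)| ≤ 2 * δ := by
  rcases le_total |x| (2 * δ) with h | h
  · rw [abs_mul]
    have h1 : |cutoff δ x - 1| ≤ 1 := by
      rw [abs_le]; constructor <;> linarith [cutoff_nonneg (δ := δ) x, cutoff_le_one (δ := δ) x]
    calc |x| * |cutoff δ x - 1| ≤ (2 * δ) * 1 := by gcongr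
      _ = 2 * δ := mul_one _
  · have : cutoff δ x = 1 := by
      unfold cutoff
      refine min_eq_left (le_max_of_le_right ?_)
      rw [le_sub_iff_add_le, le_div_iff₀ hδ]
      linarith
    rw [this, sub_self, mul_zero, abs_zero]
    positivity

end Cutoff

/-! ### Spectral cutoffs of the resolvent -/

section Approximation

variable {E : Type*} [NormedAddCommGroup E] [NormedSpace ℝ E] [FiniteDimensional ℝ E]
  {G : Type*} [Group G] [TopologicalSpace G] [ChartedSpace E G] [LieGroup 𝓘(ℝ, E) ω G]
  {ℋ : Type*} [NormedAddCommGroup ℋ] [InnerProductSpace ℂ ℋ] [CompleteSpace ℋ]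
  {U : G →* (ℋ ≃ₗᵢ[ℂ] ℋ)} {δ : ℝ}

variable (E U) in
/-- The approximation of the identity given by spectral cutoffs of the resolvent. -/
def spectralCutoff (δ : ℝ) : ℋ →L[ℂ] ℋ := cfc (cutoff δ) (resolvent E U)

/-- On the support of the cutoff T is invertible with inverse bounded by δ⁻¹, so the vectors T⁻ᵏ
χ(T) v have geometric growth; `δ ≤ 1` makes the ratio at least 1. -/
theorem spectralCutoff_mem_analyticVectors (hδ : 0 < δ) (hδ1 : δ ≤ 1) (v : ℋ) :
    spectralCutoff E U δ v ∈ analyticVectors E U := by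
  have hT : IsSelfAdjoint (resolvent E U) := isSelfAdjoint_resolvent
  have hc : ∀ k : ℕ, Continuous fun x ↦ truncInv δ x ^ k * cutoff δ x := fun k ↦
    ((continuous_truncInv hδ).pow k).mul continuous_cutoff
  have h0 : spectralCutoff E U δ v =
      cfc (fun x ↦ truncInv δ x ^ 0 * cutoff δ x) (resolvent E U) v := by
    simp only [pow_zero, one_mul]; rfl
  rw [h0]
  refine mem_analyticVectors_of_forall_resolvent_eq
    (v := fun k ↦ cfc (fun x ↦ truncInv δ x ^ k * cutoff δ x) (resolvent E U) v)
    (norm_nonneg v) ((one_le_inv₀ hδ).2 hδ1) (fun k ↦ ?_) fun k ↦ ?_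
  · have e : resolvent E U * cfc (fun x ↦ truncInv δ x ^ (k + 1) * cutoff δ x) (resolvent E U) =
        cfc (fun x ↦ truncInv δ x ^ k * cutoff δ x) (resolvent E U) := by
      nth_rewrite 1 [← cfc_id' ℝ (resolvent E U)]
      rw [← cfc_mul (fun x ↦ x) _ _ continuousOn_id (hc (k + 1)).continuousOn]
      congr 1
      ext x
      rw [← mul_truncInv_mul_cutoff hδ x, pow_succ]
      rw [mul_truncInv_mul_cutoff hδ x]
      linear_combination (truncInv δ x ^ k) * mul_truncInv_mul_cutoff hδ x
    exact congrArg (fun K : ℋ →L[ℂ] ℋ ↦ K v) e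
  · have hn : ‖cfc (fun x ↦ truncInv δ x ^ k * cutoff δ x) (resolvent E U)‖ ≤ δ⁻¹ ^ k := by
      refine norm_cfc_le (by positivity) fun x _ ↦ ?_
      rw [norm_mul, norm_pow, Real.norm_eq_abs, Real.norm_eq_abs,
        abs_of_nonneg (cutoff_nonneg x)]
      calc |truncInv δ x| ^ k * cutoff δ x ≤ δ⁻¹ ^ k * 1 := by
            gcongr
            · exact cutoff_nonneg x
            · exact abs_truncInv_le hδ x
            · exact cutoff_le_one x
        _ = _ := mul_one _
    calc _ ≤ ‖cfc (fun x ↦ truncInv δ x ^ k * cutoff δ x) (resolvent E U)‖ * ‖v‖ :=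
          ContinuousLinearMap.le_opNorm _ _
      _ ≤ δ⁻¹ ^ k * ‖v‖ := by gcongr
      _ = _ := mul_comm _ _

theorem commute_spectralCutoff_resolvent :
    Commute (spectralCutoff E U δ) (resolvent E U) := by
  have h := cfc_commute_cfc (cutoff δ) (fun x : ℝ ↦ x) (resolvent E U)
  rwa [cfc_id' ℝ (resolvent E U) isSelfAdjoint_resolvent] at h

theorem norm_spectralCutoff_resolvent_sub_le (hδ : 0 < δ) (v : ℋ) :
    ‖spectralCutoff E U δ (resolvent E U v) - resolvent E U v‖ ≤ 2 * δ * ‖v‖ := by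
  have hT : IsSelfAdjoint (resolvent E U) := isSelfAdjoint_resolvent
  have e : spectralCutoff E U δ * resolvent E U - resolvent E U =
      cfc (fun x ↦ x * (cutoff δ x - 1)) (resolvent E U) := by
    rw [commute_spectralCutoff_resolvent.eq,
      cfc_mul (fun x ↦ x) (fun x ↦ cutoff δ x - 1) _ continuousOn_id
        (continuous_cutoff.sub continuous_const).continuousOn, cfc_id' ℝ (resolvent E U),
      cfc_sub (cutoff δ) (fun _ ↦ 1) _ continuous_cutoff.continuousOn continuousOn_const,
      cfc_const_one ℝ (resolvent E U), mul_sub, mul_one]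
    rfl
  have hn : ‖cfc (fun x ↦ x * (cutoff δ x - 1)) (resolvent E U)‖ ≤ 2 * δ :=
    norm_cfc_le (by positivity) fun x _ ↦ abs_mul_cutoff_sub_one_le hδ x
  rw [← e] at hn
  exact (ContinuousLinearMap.le_opNorm (spectralCutoff E U δ * resolvent E U - resolvent E U)
    v).trans (by gcongr)

end Approximation

/-! ### Enveloping algebra elements composed with powers of the resolvent -/

section Enveloping

variable {E : Type*} [NormedAddCommGroup E] [NormedSpace ℝ E]
  {G : Type*} [Group G] [TopologicalSpace G] [ChartedSpace E G]
  {ℋ : Type*} [NormedAddCommGroup ℋ] [InnerProductSpace ℂ ℋ]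
  {U : G →* (ℋ ≃ₗᵢ[ℂ] ℋ)}

open SmoothVectors

variable (U) in
/-- The derivative at the unit element of the conjugates of an operator. -/
def opDeriv (K : ℋ →L[ℂ] ℋ) : E →L[ℝ] (ℋ →L[ℂ] ℋ) :=
  modelDeriv (fun g ↦ conjRep U g K) (1 : G)

/-- The action of a smooth operator on smooth vectors. -/
def smoothOp {K : ℋ →L[ℂ] ℋ} (hK : IsOperatorOfClass U E ∞ K) (v : SmoothVectors E U) :
    SmoothVectors E U :=
  ⟨K (incl E U v), hK.apply_mem (incl_mem v)⟩

variable [FiniteDimensional ℝ E] [LieGroup 𝓘(ℝ, E) ω G]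

-- Conjugating the derivative at 1 by U(g) gives the derivative of the conjugates along the left
-- invariant field at g, which is again smooth.
omit [FiniteDimensional ℝ E] in
theorem isOperatorOfClass_opDeriv {K : ℋ →L[ℂ] ℋ} (hK : IsOperatorOfClass U E ∞ K) (x : E) :
    IsOperatorOfClass U E ∞ (opDeriv U K x) := by
  have e : (fun g ↦ conjRep U g (opDeriv U K x)) = fun g : G ↦
      modelDeriv (E := E) (fun h : G ↦ conjRep U (g * h) K) 1 x := by
    ext1 g
    have h1 : HasMFDerivAt 𝓘(ℝ, E) 𝓘(ℝ, ℋ →L[ℂ] ℋ) (fun h : G ↦ conjRep U h K) 1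
        (opDeriv U K : E →L[ℝ] (ℋ →L[ℂ] ℋ)) :=
      (hK.mdifferentiable (by simp) 1).hasMFDerivAt
    have h2 : HasMFDerivAt 𝓘(ℝ, ℋ →L[ℂ] ℋ) 𝓘(ℝ, ℋ →L[ℂ] ℋ) (conjRep U g) (conjRep U 1 K)
        (conjRep U g) := (conjRep U g).hasFDerivAt.hasMFDerivAt
    have h3 := (h2.comp (1 : G) h1).mfderiv
    have h4 : (conjRep U g) ∘ (fun h : G ↦ conjRep U h K) = fun h : G ↦ conjRep U (g * h) K := by
      ext1 h
      exact (conjRep_mul U g h K).symm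
    rw [h4] at h3
    exact congrArg (fun T : E →L[ℝ] (ℋ →L[ℂ] ℋ) ↦ T x) h3.symm
  unfold IsOperatorOfClass
  rw [e]
  exact contMDiff_dirDeriv_mul_left hK x

/-- The product rule for `U(g) K v`. -/
theorem dOrbit_smoothOp {K : ℋ →L[ℂ] ℋ} (hK : IsOperatorOfClass U E ∞ K) (v : SmoothVectors E U)
    (x : E) : dOrbit (smoothOp hK v) x = opDeriv U K x (incl E U v) + K (dOrbit v x) := by
  let ρ : (ℋ →L[ℂ] ℋ) →L[ℝ] (ℋ →L[ℝ] ℋ) := ContinuousLinearMap.restrictScalarsL ℂ ℋ ℋ ℝ ℝ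
  have h1 : HasMFDerivAt 𝓘(ℝ, E) 𝓘(ℝ, ℋ →L[ℂ] ℋ) (fun h : G ↦ conjRep U h K) 1
      (opDeriv U K : E →L[ℝ] (ℋ →L[ℂ] ℋ)) :=
    (hK.mdifferentiable (by simp) 1).hasMFDerivAt
  have h2 : HasMFDerivAt 𝓘(ℝ, E) 𝓘(ℝ, ℋ) (orbitMap U (incl E U v)) 1
      (dOrbit v : E →L[ℝ] ℋ) := (mdifferentiable_orbitMap v (1 : G)).hasMFDerivAt
  have hp : HasMFDerivAt 𝓘(ℝ, E) 𝓘(ℝ, (ℋ →L[ℂ] ℋ) × ℋ)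
      (fun g : G ↦ (conjRep U g K, orbitMap U (incl E U v) g)) 1
      ((opDeriv U K).prod (dOrbit v) : E →L[ℝ] (ℋ →L[ℂ] ℋ) × ℋ) :=
    ⟨h1.1.prodMk h2.1, h1.2.prodMk h2.2⟩
  have hb : HasFDerivAt (fun p : (ℋ →L[ℂ] ℋ) × ℋ ↦ ρ p.1 p.2) _
      (conjRep U 1 K, orbitMap U (incl E U v) (1 : G)) :=
    HasFDerivAt.clm_apply (ρ.hasFDerivAt.comp _ hasFDerivAt_fst) hasFDerivAt_snd
  have h := (hb.hasMFDerivAt.comp (1 : G) hp).mfderiv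
  have e : (fun p : (ℋ →L[ℂ] ℋ) × ℋ ↦ ρ p.1 p.2) ∘
      (fun g : G ↦ (conjRep U g K, orbitMap U (incl E U v) g)) =
      orbitMap U (incl E U (smoothOp hK v)) := by
    ext1 g
    exact conjRep_apply_rep U g K _
  rw [e] at h
  refine (congrArg (fun T : E →L[ℝ] ℋ ↦ T x) h).trans ?_
  change conjRep U 1 K (dOrbit v x) + opDeriv U K x (U 1 (incl E U v)) = _
  rw [conjRep_one, map_one, add_comm]
  rfl

variable [CompleteSpace ℋ]

theorem incl_smoothResolvent_pow (m : ℕ) (v : SmoothVectors E U) :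
    incl E U ((smoothResolvent E U ^ m) v) = (resolvent E U ^ m) (incl E U v) := by
  induction m with
  | zero => rfl
  | succ m ih =>
    rw [pow_succ', pow_succ', Module.End.mul_apply, incl_smoothResolvent, ih]
    rfl

variable (E U) in
/-- The composition of `dU(x)` with the resolvent. -/
def derivResolvent (x : E) : ℋ →L[ℂ] ℋ :=
  ∑ i, (Module.finBasis ℝ E).repr x i • gradResolvent E U (some i)

theorem isOperatorOfClass_derivResolvent (x : E) :
    IsOperatorOfClass U E ∞ (derivResolvent E U x) :=
  .sum _ fun i _ ↦ .const_smul ((isOperatorOfClass_gradResolvent (some i)).of_le le_top) _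

theorem dOrbit_smoothResolvent (v : SmoothVectors E U) (x : E) :
    dOrbit (smoothResolvent E U v) x = derivResolvent E U x (incl E U v) := by
  conv_lhs => rw [← (Module.finBasis ℝ E).sum_repr x, map_sum]
  unfold derivResolvent
  rw [sum_apply]
  refine Finset.sum_congr rfl fun i _ ↦ ?_
  rw [map_smul, ← gradComp_some, gradComp_smoothResolvent]
  rfl

attribute [local instance 100] LieRing.ofAssociativeRing

/-- The elements of the enveloping algebra that become smooth bounded operators after composition
with a power of the resolvent. -/
def IsResolventBounded (U : G →* (ℋ ≃ₗᵢ[ℂ] ℋ))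
    (D : UniversalEnvelopingAlgebra ℝ (GroupLieAlgebra 𝓘(ℝ, E) G)) : Prop :=
  ∃ (m : ℕ) (K : ℋ →L[ℂ] ℋ), IsOperatorOfClass U E ∞ K ∧ ∀ v : SmoothVectors E U,
    incl E U (dUEnv E U D ((smoothResolvent E U ^ m) v)) = K (incl E U v)

namespace IsResolventBounded

variable {D D' : UniversalEnvelopingAlgebra ℝ (GroupLieAlgebra 𝓘(ℝ, E) G)}

theorem one : IsResolventBounded U
    (1 : UniversalEnvelopingAlgebra ℝ (GroupLieAlgebra 𝓘(ℝ, E) G)) :=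
  ⟨0, 1, .one, fun v ↦ by rw [map_one]; rfl⟩

theorem add (hD : IsResolventBounded U D) (hD' : IsResolventBounded U D') :
    IsResolventBounded U (D + D') := by
  obtain ⟨m, K, hK, h⟩ := hD
  obtain ⟨m', K', hK', h'⟩ := hD'
  have hR : IsOperatorOfClass U E ∞ (resolvent E U) := isOperatorOfClass_resolvent.of_le le_top
  -- Each operator absorbs the surplus power of the resolvent needed by the other summand.
  refine ⟨m + m', K * resolvent E U ^ m' + K' * resolvent E U ^ m,
    (hK.mul (hR.pow m')).add (hK'.mul (hR.pow m)), fun v ↦ ?_⟩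
  rw [map_add, LinearMap.add_apply, map_add]
  nth_rewrite 1 [pow_add]
  rw [add_comm m m', pow_add, Module.End.mul_apply, Module.End.mul_apply, h, h',
    incl_smoothResolvent_pow, incl_smoothResolvent_pow]
  rfl

theorem smul (hD : IsResolventBounded U D) (r : ℝ) : IsResolventBounded U (r • D) := by
  obtain ⟨m, K, hK, h⟩ := hD
  refine ⟨m, r • K, hK.const_smul r, fun v ↦ ?_⟩
  rw [map_smul]
  change incl E U ((r : ℂ) • dUEnv E U D ((smoothResolvent E U ^ m) v)) = (r : ℂ) • K (incl E U v)
  rw [map_smul, h]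

/-- By the product rule, dU(x) K T = (∂ₓK) T + K dU(x) T: one more power of T makes the last factor
bounded. Smoothness of `K`, and not only boundedness, is what keeps the induction going. -/
theorem ι_mul (hD : IsResolventBounded U D) (x : GroupLieAlgebra 𝓘(ℝ, E) G) :
    IsResolventBounded U (UniversalEnvelopingAlgebra.ι ℝ x * D) := by
  obtain ⟨m, K, hK, h⟩ := hD
  have hR : IsOperatorOfClass U E ∞ (resolvent E U) := isOperatorOfClass_resolvent.of_le le_top
  let y : E := x
  refine ⟨m + 1, opDeriv U K y * resolvent E U + K * derivResolvent E U y,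
    ((isOperatorOfClass_opDeriv hK y).mul hR).add (hK.mul (isOperatorOfClass_derivResolvent y)),
    fun v ↦ ?_⟩
  have e : dUEnv E U D ((smoothResolvent E U ^ (m + 1)) v) =
      smoothOp hK (smoothResolvent E U v) := by
    apply incl_injective
    rw [pow_succ, Module.End.mul_apply, h]
    rfl
  have e' : dUEnv E U (UniversalEnvelopingAlgebra.ι ℝ x) = dU E U x :=
    UniversalEnvelopingAlgebra.lift_ι_apply ℝ (dULie E U) x
  rw [map_mul, Module.End.mul_apply, e, e']
  change dOrbit (smoothOp hK (smoothResolvent E U v)) y = _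
  rw [dOrbit_smoothOp, dOrbit_smoothResolvent]
  rfl

end IsResolventBounded

/-- Every element of the enveloping algebra becomes a smooth bounded operator after composition with
a power of the resolvent. -/
theorem isResolventBounded (D : UniversalEnvelopingAlgebra ℝ (GroupLieAlgebra 𝓘(ℝ, E) G)) :
    IsResolventBounded U D := by
  -- Induction over the enveloping algebra: the left multipliers of the property form a subalgebra
  -- containing the Lie algebra, hence everything by the universal property. Multipliers are used
  -- because closure of the property itself under products is not at hand.
  let S : Subalgebra ℝ (UniversalEnvelopingAlgebra ℝ (GroupLieAlgebra 𝓘(ℝ, E) G)) :=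
    { carrier := {D | ∀ D', IsResolventBounded U D' → IsResolventBounded U (D * D')}
      mul_mem' := fun {a b} ha hb D' hD' ↦ by rw [mul_assoc]; exact ha _ (hb _ hD')
      add_mem' := fun {a b} ha hb D' hD' ↦ by rw [add_mul]; exact (ha _ hD').add (hb _ hD')
      algebraMap_mem' := fun r D' hD' ↦ by rw [← Algebra.smul_def]; exact hD'.smul r }
  let f : GroupLieAlgebra 𝓘(ℝ, E) G →ₗ⁅ℝ⁆ S :=
    { toFun := fun x ↦ ⟨UniversalEnvelopingAlgebra.ι ℝ x, fun D' hD' ↦ hD'.ι_mul x⟩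
      map_add' := fun x y ↦ Subtype.ext (map_add _ x y)
      map_smul' := fun r x ↦ Subtype.ext (map_smul _ r x)
      map_lie' := fun {x y} ↦ Subtype.ext (LieHom.map_lie _ x y) }
  have h : S.val.comp (UniversalEnvelopingAlgebra.lift ℝ f) = AlgHom.id ℝ _ := by
    apply UniversalEnvelopingAlgebra.hom_ext
    ext x
    change ((UniversalEnvelopingAlgebra.lift ℝ f (UniversalEnvelopingAlgebra.ι ℝ x) : S) :
      UniversalEnvelopingAlgebra ℝ (GroupLieAlgebra 𝓘(ℝ, E) G)) = _
    rw [UniversalEnvelopingAlgebra.lift_ι_apply]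
    rfl
  have hD : D ∈ S := by
    have := (UniversalEnvelopingAlgebra.lift ℝ f D).2
    rwa [show ((UniversalEnvelopingAlgebra.lift ℝ f D : S) : UniversalEnvelopingAlgebra ℝ
      (GroupLieAlgebra 𝓘(ℝ, E) G)) = D from congrArg (fun φ ↦ φ D) h] at this
  have := hD 1 .one
  rwa [mul_one] at this

end Enveloping

/-! ### Convergence in the Fréchet topology -/

section Density

variable {E : Type*} [NormedAddCommGroup E] [NormedSpace ℝ E] [FiniteDimensional ℝ E]
  {G : Type*} [Group G] [TopologicalSpace G] [ChartedSpace E G] [LieGroup 𝓘(ℝ, E) ω G]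
  {ℋ : Type*} [NormedAddCommGroup ℋ] [InnerProductSpace ℂ ℋ] [CompleteSpace ℋ]
  {U : G →* (ℋ ≃ₗᵢ[ℂ] ℋ)}

open SmoothVectors

/-- The analytic vectors `f(T) v`, where `f` is a spectral cutoff and `T` the resolvent, as smooth
vectors. -/
def analyticApprox {δ : ℝ} (hδ : 0 < δ) (hδ1 : δ ≤ 1) (v : SmoothVectors E U) :
    SmoothVectors E U :=
  ⟨spectralCutoff E U δ (incl E U v),
    ContMDiff.of_le (spectralCutoff_mem_analyticVectors hδ hδ1 (incl E U v)) le_top⟩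

/-- The analytic approximations converge in the Fréchet topology. Only vectors in the norm closure of
the smooth vectors are involved, so that the strong continuity of `U` is not needed. -/
theorem seminorms_analyticApprox_sub_le
    (D : UniversalEnvelopingAlgebra ℝ (GroupLieAlgebra 𝓘(ℝ, E) G)) (v : SmoothVectors E U) :
    ∃ C : ℝ, 0 ≤ C ∧ ∀ {δ : ℝ} (hδ : 0 < δ) (hδ1 : δ ≤ 1),
      seminorms E U D (analyticApprox hδ hδ1 v - v) ≤ C * δ := by
  obtain ⟨m, K, -, h⟩ := isResolventBounded (U := U) D
  -- Of the m + 1 factors T split off from the vector, m make `D` bounded and the last one makes the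
  -- spectral error at most `2 * δ`.
  obtain ⟨w, rfl⟩ := smoothResolvent_pow_surjective m v
  obtain ⟨u, rfl⟩ := smoothResolvent_surjective w
  refine ⟨‖K‖ * (2 * ‖incl E U u‖), by positivity, fun {δ} hδ hδ1 ↦ ?_⟩
  set w := smoothResolvent E U u with hw
  have e : analyticApprox hδ hδ1 ((smoothResolvent E U ^ m) w) - (smoothResolvent E U ^ m) w =
      (smoothResolvent E U ^ m) (analyticApprox hδ hδ1 w - w) := by
    rw [map_sub]
    congr 1
    apply incl_injective
    rw [incl_smoothResolvent_pow]
    change spectralCutoff E U δ (incl E U ((smoothResolvent E U ^ m) w)) =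
      (resolvent E U ^ m) (spectralCutoff E U δ (incl E U w))
    rw [incl_smoothResolvent_pow]
    exact congrArg (fun L : ℋ →L[ℂ] ℋ ↦ L (incl E U w))
      (commute_spectralCutoff_resolvent.pow_right m).eq
  change ‖incl E U (dUEnv E U D _)‖ ≤ _
  rw [e, h]
  have hs : ‖incl E U (analyticApprox hδ hδ1 w - w)‖ ≤ 2 * δ * ‖incl E U u‖ := by
    rw [map_sub]
    exact norm_spectralCutoff_resolvent_sub_le hδ (incl E U u)
  calc ‖K (incl E U (analyticApprox hδ hδ1 w - w))‖
      ≤ ‖K‖ * (2 * δ * ‖incl E U u‖) := (K.le_opNorm _).trans (by gcongr)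
    _ = _ := by ring

end Density

end

end UnitaryLieRep

theorem theorem2
    {E : Type*} [NormedAddCommGroup E] [NormedSpace ℝ E] [FiniteDimensional ℝ E]
    {G : Type*} [Group G] [TopologicalSpace G] [ChartedSpace E G] [LieGroup 𝓘(ℝ, E) ω G]
    {ℋ : Type*} [NormedAddCommGroup ℋ] [InnerProductSpace ℂ ℋ] [CompleteSpace ℋ]
    (U : G →* (ℋ ≃ₗᵢ[ℂ] ℋ)) (hU : ∀ v : ℋ, Continuous fun g : G ↦ U g v) :
    Dense {v : UnitaryLieRep.SmoothVectors E U |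
      UnitaryLieRep.SmoothVectors.incl E U v ∈ UnitaryLieRep.analyticVectors E U} := by
  open UnitaryLieRep SmoothVectors in
  intro v
  have hδ : ∀ n : ℕ, (0 : ℝ) < 1 / (n + 1) := fun n ↦ Nat.one_div_pos_of_nat
  have hδ1 : ∀ n : ℕ, (1 : ℝ) / (n + 1) ≤ 1 := fun n ↦ by
    rw [div_le_one (by positivity)]
    linarith [(Nat.cast_nonneg n : (0 : ℝ) ≤ n)]
  refine mem_closure_of_tendsto (f := fun n : ℕ ↦ analyticApprox (hδ n) (hδ1 n) v)
    (b := Filter.atTop) ?_ (Filter.Eventually.of_forall fun n ↦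
      spectralCutoff_mem_analyticVectors (hδ n) (hδ1 n) _)
  rw [(withSeminorms E U).tendsto_nhds]
  intro D ε hε
  obtain ⟨C, hC, h⟩ := seminorms_analyticApprox_sub_le D v
  have ht : Filter.Tendsto (fun n : ℕ ↦ C * (1 / ((n : ℝ) + 1))) Filter.atTop (𝓝 0) := by
    simpa using (tendsto_one_div_add_atTop_nhds_zero_nat (𝕜 := ℝ)).const_mul C
  filter_upwards [ht.eventually_lt_const hε] with n hn
  exact (h (hδ n) (hδ1 n)).trans_lt hn
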